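/- **Setting.** In round $t=1,2,\dots$ a non-empty subset $\mathcal A_t$ of a finite set of arms is offered; arm $a$ has a feature vector $\mathbf x_{t,a}\in\mathbb R^d$ ($d\ge1$), and the user of the round belongs to one of two groups $S_t\in\{s^+,s^-\}$. Pulling arm $a$ yields the reward $r_{t,a}=\langle\boldsymbol\theta^*,\mathbf x_{t,a}\rangle+\epsilon_{t,a}$. Let $(\mathcal F_t)_{t\ge 0}$ be a filtration such that $\mathcal A_t,\mathbf x_{t,a},S_t$ and the pulled arm $a_t$ are $\mathcal F_{t-1}$-measurable and the observed payoff $r_{t,a_t}$ is $\mathcal F_t$-measurable. Assume for all $t,a$: $\epsilon_{t,a}$ is conditionally $1$-sub-Gaussian given $\mathcal F_{t-1}$, i.e. $\mathbb E[e^{u\epsilon_{t,a}}\mid\mathcal F_{t-1}]\le e^{u^2/2}$ for all $u\in\mathbb R$; $r_{t,a}\in[0,1]$ almost surely; $\|\mathbf x_{t,a}\|_2<L$; and $\|\boldsymbol\theta^*\|_2<M$. **Fair-LinUCB** with parameters $\lambda>0$, $\gamma\ge0$ and $\alpha_t$. Put $A_t=\lambda I_d+\sum_{s<t}\mathbf x_{s,a_s}\mathbf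 x_{s,a_s}^{\mathrm T}$, $\hat{\boldsymbol\theta}_t=A_t^{-1}\sum_{s<t}r_{s,a_s}\mathbf x_{s,a_s}$ and $\|\mathbf x\|_{A}=\sqrt{\mathbf x^{\mathrm T}A\mathbf x}$. Let $\bar r^{s^\pm}$ be the mean payoff of the rounds before $t$ whose user is in group $s^\pm$, and $\bar r_a^{s^\pm}$ the mean over those of these rounds in which $a$ was pulled (an empty mean is $0$), and let $F_a=-\operatorname{sign}(\bar r^{s^+}-\bar r^{s^-})\,(\bar r_a^{s^+}-\bar r_a^{s^-})$. In round $t$ the algorithm pulls an arm $a_t\in\mathcal A_t$ that maximizes, with ties broken arbitrarily, $$p_{t,a}=\hat{\boldsymbol\theta}_t^{\mathrm T}\mathbf x_{t,a}+\alpha_t\|\mathbf x_{t,a}\|_{A_t^{-1}}+\frac{\alpha_t\min_{a'\in\mathcal A_t}\|\mathbf x_{t,a'}\|_{A_t^{-1}}}{2}\,(F_a+1)\,\gamma .$$ For a horizon $T\ge2$ and confidence level $\delta=1/T$, the exploration parameters $\alpha_t$ are $\mathcal F_{t-1}$-measurable and lie, for $1\le t\le T$, between the two confidence radii: $$\sqrt\lambda\,\|\boldsymbol\theta^*\|_2+\sqrt{2\log\frac{|A_t|^{1/2}}{|\lambda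 I_d|^{1/2}\,\delta}}\ \le\ \alpha_t\ \le\ \sqrt\lambda\,M+\sqrt{2\log\tfrac1\delta+d\log\Bigl(1+\tfrac{TL^2}{d\lambda}\Bigr)} .$$ **Corollary.** For all $\lambda>0$, $M$, $\Gamma\ge0$ and $c>1$ there is a constant $C'>0$, depending only on $\lambda,M,\Gamma,c$, such that in the above setting, for all $d\ge1$, $T\ge2$, $L$ with $TL\ge c$ and all $0\le\gamma\le\Gamma$, the following holds. Let $a_t^*\in\mathcal A_t$ be an ($\mathcal F_{t-1}$-measurable) arm maximizing $\langle\boldsymbol\theta^*,\mathbf x_{t,a}\rangle$. Then with probability at least $1-1/T$ $$R_T=\sum_{t=1}^T\bigl(\langle\boldsymbol\theta^*,\mathbf x_{t,a_t^*}\rangle-\langle\boldsymbol\theta^*,\mathbf x_{t,a_t}\rangle\bigr)\ \le\ C'\,d\,\sqrt T\,\log(TL),$$ and the expected regret satisfies the same bound: $$\mathbb E\Bigl[\sum_{t=1}^T r_{t,a_t^*}\Bigr]-\mathbb E\Bigl[\sum_{t=1}^T r_{t,a_t}\Bigr]\ \le\ C'\,d\,\sqrt T\,\log(TL).$$ -/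

import Mathlib

namespace FairLinUCB

open MeasureTheory

noncomputable section

/-- The feature space `ℝ^d` with the Euclidean norm. -/
abbrev Feature (d : ℕ) : Type := EuclideanSpace ℝ (Fin d)

/-- The weighted norm `‖v‖_A = √(vᵀ A v)`. -/
def wnorm {d : ℕ} (A : Matrix (Fin d) (Fin d) ℝ) (v : Feature d) : ℝ :=
  √(v.ofLp ⬝ᵥ A.mulVec v.ofLp)

/-! ### Ridge regression along one run
`X s` is the feature vector of the arm pulled in round `s` and `R s` the payoff observed in it.
Rounds are numbered `0, 1, 2, …`; the statistics used to decide in round `t` are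
built from the rounds `s < t`. -/

/-- `A_t = λ I + ∑_{s<t} x_s x_sᵀ`. -/
def gram {d : ℕ} (lam : ℝ) (X : ℕ → Feature d) (t : ℕ) : Matrix (Fin d) (Fin d) ℝ :=
  lam • (1 : Matrix (Fin d) (Fin d) ℝ)
    + ∑ s ∈ Finset.range t, Matrix.vecMulVec (X s).ofLp (X s).ofLp

/-- `b_t = ∑_{s<t} r_s x_s`. -/
def bvec {d : ℕ} (X : ℕ → Feature d) (R : ℕ → ℝ) (t : ℕ) : Feature d :=
  ∑ s ∈ Finset.range t, R s • X s

/-- The ridge estimator `θ̂_t = A_t⁻¹ b_t`. -/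
def ridge {d : ℕ} (lam : ℝ) (X : ℕ → Feature d) (R : ℕ → ℝ) (t : ℕ) : Feature d :=
  WithLp.toLp 2 ((gram lam X t)⁻¹.mulVec (bvec X R t).ofLp)

/-- The self-normalized confidence radius
`√λ ‖θ‖ + √(2 log(|A_t|^{1/2} |λ I|^{-1/2} δ⁻¹))`. -/
def confRadius {d : ℕ} (lam δ : ℝ) (θ : Feature d) (X : ℕ → Feature d) (t : ℕ) : ℝ :=
  √lam * ‖θ‖ + √(2 * Real.log (√(gram lam X t).det
    * (√(lam • (1 : Matrix (Fin d) (Fin d) ℝ)).det)⁻¹ * δ⁻¹))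

/-- The deterministic confidence radius
`√λ M + √(2 log(1/δ) + d log(1 + T L² / (d λ)))` for the horizon `T`. -/
def horizonRadius (d T : ℕ) (lam δ L M : ℝ) : ℝ :=
  √lam * M + √(2 * Real.log (1 / δ) + d * Real.log (1 + T * L ^ 2 / (d * lam)))

/-! ### The bandit and its assumptions -/

/-- `η` is conditionally 1-sub-Gaussian given the σ-algebra `m`:
`E[exp(sη) | m] ≤ exp(s²/2)` for every real `s`. -/
def CondSubGaussian {Ω : Type*} [MeasurableSpace Ω] (μ : Measure Ω) (m : MeasurableSpace Ω)
    (η : Ω → ℝ) : Prop :=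
  ∀ s : ℝ, Integrable (fun ω => Real.exp (s * η ω)) μ ∧
    μ[fun ω => Real.exp (s * η ω)|m] ≤ᵐ[μ] fun _ => Real.exp (s ^ 2 / 2)

/-- The data of a linear contextual bandit with a binary sensitive attribute. The σ-algebra `F t`
is the information available when the arm of round `t` is chosen. -/
structure Bandit (d : ℕ) (Arm Ω : Type*) [mΩ : MeasurableSpace Ω] where
  F : Filtration ℕ mΩ
  /-- the arms offered in round `t` -/
  avail : ℕ → Ω → Finset Arm
  avail_nonempty : ∀ t ω, (avail t ω).Nonempty
  /-- the contextual feature vector of an arm -/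
  x : ℕ → Arm → Ω → Feature d
  /-- whether the user of round `t` belongs to the privileged group `s⁺` -/
  privileged : ℕ → Ω → Bool
  /-- the reward that an arm yields if it is pulled in round `t` -/
  reward : ℕ → Arm → Ω → ℝ
  /-- the true coefficient vector, shared by all arms -/
  θ : Feature d

namespace Bandit

variable {d : ℕ} {Arm Ω : Type*} [MeasurableSpace Ω]

/-- The expected reward `⟨θ, x_{t,a}⟩`. -/
def mean (B : Bandit d Arm Ω) (t : ℕ) (a : Arm) (ω : Ω) : ℝ := inner ℝ B.θ (B.x t a ω)

/-- The noise, so that `r_{t,a} = ⟨θ, x_{t,a}⟩ + ε_{t,a}`. -/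
def noise (B : Bandit d Arm Ω) (t : ℕ) (a : Arm) (ω : Ω) : ℝ := B.reward t a ω - B.mean t a ω

/-- The assumptions on the environment. Features and rewards of arms not on offer
play no role (they may be taken to be `0`). -/
structure Assumptions (B : Bandit d Arm Ω) (μ : Measure Ω) (L M : ℝ) : Prop where
  avail_predictable : ∀ t a, MeasurableSet[B.F t] {ω | a ∈ B.avail t ω}
  x_predictable : ∀ t a, Measurable[B.F t] (B.x t a)
  privileged_predictable : ∀ t, MeasurableSet[B.F t] {ω | B.privileged t ω = true}
  reward_measurable : ∀ t a, Measurable (B.reward t a)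
  noise_subGaussian : ∀ t a, CondSubGaussian μ (B.F t) (B.noise t a)
  reward_mem : ∀ t a, ∀ᵐ ω ∂μ, B.reward t a ω ∈ Set.Icc (0 : ℝ) 1
  norm_x_lt : ∀ t a ω, ‖B.x t a ω‖ < L
  norm_θ_lt : ‖B.θ‖ < M

/-- An arm selection is predictable if the arm of round `t` is determined by `F t`. -/
def Predictable (B : Bandit d Arm Ω) (arm : ℕ → Ω → Arm) : Prop :=
  ∀ t a, MeasurableSet[B.F t] {ω | arm t ω = a}

/-- `best t` is an arm on offer with the largest expected reward. -/
structure IsBestArm (B : Bandit d Arm Ω) (best : ℕ → Ω → Arm) : Prop where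
  predictable : B.Predictable best
  mem : ∀ t ω, best t ω ∈ B.avail t ω
  le : ∀ t ω, ∀ a ∈ B.avail t ω, B.mean t a ω ≤ B.mean t (best t ω) ω

/-- The features of the arms pulled on the sample path `ω`. -/
def pulledX (B : Bandit d Arm Ω) (arm : ℕ → Ω → Arm) (ω : Ω) (s : ℕ) : Feature d :=
  B.x s (arm s ω) ω

/-- The payoffs observed on the sample path `ω`. -/
def payoff (B : Bandit d Arm Ω) (arm : ℕ → Ω → Arm) (ω : Ω) (s : ℕ) : ℝ :=
  B.reward s (arm s ω) ω

/-- The matrix `A_t` on the sample path `ω`. -/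
def A (B : Bandit d Arm Ω) (lam : ℝ) (arm : ℕ → Ω → Arm) (t : ℕ) (ω : Ω) :
    Matrix (Fin d) (Fin d) ℝ :=
  gram lam (B.pulledX arm ω) t

/-- The confidence width `‖x_{t,a}‖_{A_t⁻¹}`. -/
def width (B : Bandit d Arm Ω) (lam : ℝ) (arm : ℕ → Ω → Arm) (t : ℕ) (a : Arm) (ω : Ω) : ℝ :=
  wnorm (B.A lam arm t ω)⁻¹ (B.x t a ω)

/-- `‖x_{t,a_m}‖_{A_t⁻¹}`, the smallest confidence width among the arms on offer. -/
def minWidth (B : Bandit d Arm Ω) (lam : ℝ) (arm : ℕ → Ω → Arm) (t : ℕ) (ω : Ω) : ℝ :=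
  (B.avail t ω).inf' (B.avail_nonempty t ω) fun a => B.width lam arm t a ω

open Classical in
/-- The mean payoff of the rounds `s < t` that satisfy `P`; it is `0` if there is none. -/
def meanPayoff (B : Bandit d Arm Ω) (arm : ℕ → Ω → Arm) (ω : Ω) (t : ℕ) (P : ℕ → Prop) : ℝ :=
  (∑ s ∈ Finset.range t with P s, B.payoff arm ω s) /
    ((Finset.range t).filter P).card

/-- The mean reward `r̄^s` of the group `s` before round `t` (`g = true` for `s⁺`). -/
def groupMean (B : Bandit d Arm Ω) (arm : ℕ → Ω → Arm) (t : ℕ) (ω : Ω) (g : Bool) : ℝ :=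
  B.meanPayoff arm ω t fun s => B.privileged s ω = g

/-- The mean reward `r̄_a^s` that the arm `a` generated for the group `s` before round `t`. -/
def armGroupMean (B : Bandit d Arm Ω) (arm : ℕ → Ω → Arm) (t : ℕ) (a : Arm) (ω : Ω)
    (g : Bool) : ℝ :=
  B.meanPayoff arm ω t fun s => B.privileged s ω = g ∧ arm s ω = a

/-- The fairness penalty `F_a = -sign(r̄^{s⁺} - r̄^{s⁻}) (r̄_a^{s⁺} - r̄_a^{s⁻})`. -/
def penalty (B : Bandit d Arm Ω) (arm : ℕ → Ω → Arm) (t : ℕ) (a : Arm) (ω : Ω) : ℝ :=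
  -Real.sign (B.groupMean arm t ω true - B.groupMean arm t ω false)
    * (B.armGroupMean arm t a ω true - B.armGroupMean arm t a ω false)

/-- The index `p_{t,a} = θ̂_tᵀ x_{t,a} + α_t ‖x_{t,a}‖_{A_t⁻¹} + 𝓛(γ, F_a)`, where
`𝓛(γ, F) = (α_t ‖x_{t,a_m}‖_{A_t⁻¹} / 2) (F + 1) γ`. -/
def index (B : Bandit d Arm Ω) (lam γ : ℝ) (α : ℕ → Ω → ℝ) (arm : ℕ → Ω → Arm)
    (t : ℕ) (a : Arm) (ω : Ω) : ℝ :=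
  inner ℝ (ridge lam (B.pulledX arm ω) (B.payoff arm ω) t) (B.x t a ω)
    + α t ω * B.width lam arm t a ω
    + α t ω * B.minWidth lam arm t ω / 2 * (B.penalty arm t a ω + 1) * γ

/-- `arm` is a run of Fair-LinUCB: each round it pulls an arm on offer with maximal index (ties are
broken by any predictable rule), and then the payoff of that arm is observed. -/
structure IsFairLinUCB (B : Bandit d Arm Ω) (lam γ : ℝ) (α : ℕ → Ω → ℝ)
    (arm : ℕ → Ω → Arm) : Prop where
  predictable : B.Predictable arm
  payoff_observed : ∀ t, Measurable[B.F (t + 1)] fun ω => B.payoff arm ω t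
  mem : ∀ t ω, arm t ω ∈ B.avail t ω
  index_le : ∀ t ω, ∀ a ∈ B.avail t ω,
    B.index lam γ α arm t a ω ≤ B.index lam γ α arm t (arm t ω) ω

/-- The exploration parameters `α_t` are non-anticipating and, up to the horizon `T`, at least
the self-normalized and at most the deterministic confidence radius at level `δ`. -/
structure IsExploration (B : Bandit d Arm Ω) (T : ℕ) (lam δ L M : ℝ) (arm : ℕ → Ω → Arm)
    (α : ℕ → Ω → ℝ) : Prop where
  predictable : ∀ t, Measurable[B.F t] (α t)
  ge : ∀ t < T, ∀ ω, confRadius lam δ B.θ (B.pulledX arm ω) t ≤ α t ω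
  le : ∀ t < T, ∀ ω, α t ω ≤ horizonRadius d T lam δ L M

/-- The cumulative regret `∑_{t<T} (⟨θ, x_{t,a*}⟩ - ⟨θ, x_{t,a_t}⟩)` on the sample path `ω`. -/
def regret (B : Bandit d Arm Ω) (best arm : ℕ → Ω → Arm) (T : ℕ) (ω : Ω) : ℝ :=
  ∑ t ∈ Finset.range T, (B.mean t (best t ω) ω - B.mean t (arm t ω) ω)

/-- The expected regret `E[∑_{t<T} r_{t,a*}] - E[∑_{t<T} r_{t,a_t}]`. -/
def expectedRegret (B : Bandit d Arm Ω) (μ : Measure Ω) (best arm : ℕ → Ω → Arm) (T : ℕ) : ℝ :=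
  (∫ ω, ∑ t ∈ Finset.range T, B.reward t (best t ω) ω ∂μ)
    - ∫ ω, ∑ t ∈ Finset.range T, B.reward t (arm t ω) ω ∂μ

end Bandit

end

end FairLinUCB

/-!
The fairness penalties lie in `[-1, 1]`, so the fairness terms of two arms differ by at most `γ α_t`
times the least width `‖x‖_{A_t⁻¹}` on offer. Where every mean reward is estimated within `α_t`
times its width, an arm of maximal index therefore loses at most `(2 + γ) α_t` times its own width.
The loss is also at most one, and the widths `w` capped at one have a sum of squares that telescopes
through the determinant lemma: `min 1 w² ≤ 2 log (1 + w²)` and `det A_{t+1} = (1 + w²) det A_t`.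

The estimates hold by the method of mixtures. Let `Z_t = ∑_{s<t} ε_s x_s`. Averaging the exponential
supermartingales `exp (⟨u, Z_t⟩ - ∑_{s<t} ⟨u, x_s⟩² / 2)` over a Gaussian `u` of covariance `λ⁻¹ I`
gives `√(det (λ I) / det A_t) exp (‖Z_t‖²_{A_t⁻¹} / 2)`, which by Ville's inequality stays below
`1 / δ` with probability at least `1 - δ`. The supermartingale property is checked round by round:
given the past, `⟨u, x_t⟩` is Gaussian under the mixture, with variance the squared width of `x_t`.

On the exceptional event the regret is at most `T`, which adds `T δ = 1` to the expectation.
-/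

namespace FairLinUCB

open MeasureTheory ProbabilityTheory
open scoped ENNReal NNReal Matrix

/-! ### Rank-one updates and positive definite matrices -/

section LinearAlgebra

variable {n : Type*} [Fintype n]

section RankOne

variable [DecidableEq n]

variable {R : Type*} [CommRing R] {A : Matrix n n R}

lemma mulVec_inv_mulVec (hA : IsUnit A.det) (v : n → R) : A *ᵥ A⁻¹ *ᵥ v = v := by
  rw [Matrix.mulVec_mulVec, Matrix.mul_nonsing_inv _ hA, Matrix.one_mulVec]

lemma inv_mulVec_mulVec (hA : IsUnit A.det) (v : n → R) : A⁻¹ *ᵥ A *ᵥ v = v := by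
  rw [Matrix.mulVec_mulVec, Matrix.nonsing_inv_mul _ hA, Matrix.one_mulVec]

lemma det_add_vecMulVec (hA : IsUnit A.det) (u v : n → R) :
    (A + Matrix.vecMulVec u v).det = A.det * (1 + v ⬝ᵥ A⁻¹ *ᵥ u) := by
  rw [Matrix.vecMulVec_eq Unit, Matrix.det_add_replicateCol_mul_replicateRow hA,
    Matrix.mul_assoc, ← Matrix.replicateCol_mulVec, Matrix.det_unique (n := Unit),
    Matrix.add_apply, Matrix.one_apply_eq, Matrix.replicateRow_mul_replicateCol_apply]

variable {K : Type*} [Field K] {A : Matrix n n K} {u v : n → K}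

lemma inv_add_vecMulVec_mulVec (hA : IsUnit A.det) (huv : 1 + v ⬝ᵥ A⁻¹ *ᵥ u ≠ 0) (w : n → K) :
    (A + Matrix.vecMulVec u v)⁻¹ *ᵥ w =
      A⁻¹ *ᵥ w - ((v ⬝ᵥ A⁻¹ *ᵥ w) / (1 + v ⬝ᵥ A⁻¹ *ᵥ u)) • A⁻¹ *ᵥ u := by
  have hunit : IsUnit (A + Matrix.vecMulVec u v).det := by
    rw [det_add_vecMulVec hA]
    exact hA.mul huv.isUnit
  have hsolve : (A + Matrix.vecMulVec u v) *ᵥ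
      (A⁻¹ *ᵥ w - ((v ⬝ᵥ A⁻¹ *ᵥ w) / (1 + v ⬝ᵥ A⁻¹ *ᵥ u)) • A⁻¹ *ᵥ u) = w := by
    ext i
    simp only [Matrix.add_mulVec, Matrix.mulVec_sub, Matrix.mulVec_smul, mulVec_inv_mulVec hA,
      Matrix.vecMulVec_mulVec, Pi.add_apply,
      Pi.sub_apply, Pi.smul_apply, MulOpposite.smul_eq_mul_unop, MulOpposite.unop_op, smul_eq_mul]
    field_simp
    ring
  conv_lhs => rw [← hsolve, inv_mulVec_mulVec hunit]

lemma dotProduct_inv_add_vecMulVec_mulVec (hA : IsUnit A.det) (hsymm : A.IsSymm)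
    (hu : 1 + u ⬝ᵥ A⁻¹ *ᵥ u ≠ 0) (s : n → K) (η : K) :
    (s + η • u) ⬝ᵥ (A + Matrix.vecMulVec u u)⁻¹ *ᵥ (s + η • u) =
      s ⬝ᵥ A⁻¹ *ᵥ s + (2 * η * (u ⬝ᵥ A⁻¹ *ᵥ s) + η ^ 2 * (u ⬝ᵥ A⁻¹ *ᵥ u)
        - (u ⬝ᵥ A⁻¹ *ᵥ s) ^ 2) / (1 + u ⬝ᵥ A⁻¹ *ᵥ u) := by
  have hcomm : s ⬝ᵥ A⁻¹ *ᵥ u = u ⬝ᵥ A⁻¹ *ᵥ s := by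
    rw [Matrix.dotProduct_mulVec, ← Matrix.mulVec_transpose, Matrix.transpose_nonsing_inv,
      hsymm.eq, dotProduct_comm]
  rw [inv_add_vecMulVec_mulVec hA hu]
  simp only [Matrix.mulVec_add, Matrix.mulVec_smul, add_dotProduct, dotProduct_add,
    dotProduct_sub, smul_dotProduct, dotProduct_smul, smul_eq_mul, hcomm]
  field_simp
  ring

end RankOne

section PosSemidef

variable {A : Matrix n n ℝ}

lemma dotProduct_mulVec_nonneg (hA : A.PosSemidef) (v : n → ℝ) : 0 ≤ v ⬝ᵥ A *ᵥ v := by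
  simpa only [star_trivial] using hA.dotProduct_mulVec_nonneg v

lemma sq_dotProduct_mulVec_le (hA : A.PosSemidef) (u v : n → ℝ) :
    (u ⬝ᵥ A *ᵥ v) ^ 2 ≤ (u ⬝ᵥ A *ᵥ u) * (v ⬝ᵥ A *ᵥ v) := by
  classical
  have hsymm : (Matrix.toBilin' A).IsSymm :=
    Matrix.isSymm_toBilin'_iff_isSymm.2 (Matrix.isHermitian_iff_isSymm.1 hA.isHermitian)
  simpa only [Matrix.toBilin'_apply'] using LinearMap.BilinForm.apply_sq_le_of_symm
    (Matrix.toBilin' A)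
    (fun w => by simpa only [Matrix.toBilin'_apply'] using dotProduct_mulVec_nonneg hA w)
    (LinearMap.BilinForm.isSymm_iff.1 hsymm) u v

variable [DecidableEq n]

-- With `w = A⁻¹ v`, combine `c (w ⬝ᵥ w) ≤ w ⬝ᵥ v` with `0 ≤ ‖c w - v‖²`.
lemma dotProduct_inv_mulVec_le_div {c : ℝ} (hc : 0 < c) (hA : (A - c • 1).PosSemidef)
    (v : n → ℝ) : v ⬝ᵥ A⁻¹ *ᵥ v ≤ (v ⬝ᵥ v) / c := by
  have hunit : IsUnit A.det := by
    have hpd : A.PosDef := by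
      simpa using Matrix.PosDef.posSemidef_add hA (Matrix.PosDef.one.smul hc)
    exact hpd.det_pos.ne'.isUnit
  set w := A⁻¹ *ᵥ v
  have hAw : A *ᵥ w = v := mulVec_inv_mulVec hunit v
  have hcoercive := dotProduct_mulVec_nonneg hA w
  have hsq : 0 ≤ (c • w - v) ⬝ᵥ (c • w - v) := dotProduct_self_star_nonneg (c • w - v)
  simp only [Matrix.sub_mulVec, Matrix.smul_mulVec, Matrix.one_mulVec, hAw, sub_dotProduct,
    dotProduct_sub, smul_dotProduct, dotProduct_smul, smul_eq_mul, dotProduct_comm w v]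
    at hcoercive hsq
  rw [le_div_iff₀ hc]
  nlinarith

lemma det_le_trace_div_card_pow (hA : A.PosSemidef) :
    A.det ≤ (A.trace / Fintype.card n) ^ Fintype.card n := by
  rcases isEmpty_or_nonempty n with hn | hn
  · simp
  have hdet : A.det = ∏ i, hA.isHermitian.eigenvalues i := by
    simpa using hA.isHermitian.det_eq_prod_eigenvalues
  have htrace : A.trace = ∑ i, hA.isHermitian.eigenvalues i := by
    simpa using hA.isHermitian.trace_eq_sum_eigenvalues
  have hamgm : A.det ^ (Fintype.card n : ℝ)⁻¹ ≤ A.trace / Fintype.card n := by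
    simpa [hdet, htrace, Fintype.card_pos] using Real.geom_mean_le_arith_mean Finset.univ
      (fun _ => 1) hA.isHermitian.eigenvalues (by simp) (by simp [Fintype.card_pos])
      fun i _ => hA.eigenvalues_nonneg i
  calc A.det = (A.det ^ (Fintype.card n : ℝ)⁻¹) ^ Fintype.card n :=
        (Real.rpow_inv_natCast_pow hA.det_nonneg Fintype.card_ne_zero).symm
    _ ≤ _ := pow_le_pow_left₀ (Real.rpow_nonneg hA.det_nonneg _) hamgm _

end PosSemidef

end LinearAlgebra

/-! ### The regularized Gram matrix -/

section Gram

variable {d : ℕ}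

lemma wnorm_nonneg (A : Matrix (Fin d) (Fin d) ℝ) (v : Feature d) : 0 ≤ wnorm A v :=
  Real.sqrt_nonneg _

lemma sq_wnorm {A : Matrix (Fin d) (Fin d) ℝ} (hA : A.PosSemidef) (v : Feature d) :
    wnorm A v ^ 2 = v.ofLp ⬝ᵥ A *ᵥ v.ofLp :=
  Real.sq_sqrt (dotProduct_mulVec_nonneg hA _)

lemma abs_dotProduct_mulVec_le_wnorm_mul_wnorm {A : Matrix (Fin d) (Fin d) ℝ}
    (hA : A.PosSemidef) (u v : Feature d) :
    |u.ofLp ⬝ᵥ A *ᵥ v.ofLp| ≤ wnorm A u * wnorm A v := by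
  rw [wnorm, wnorm, ← Real.sqrt_mul (dotProduct_mulVec_nonneg hA _)]
  exact Real.abs_le_sqrt (sq_dotProduct_mulVec_le hA _ _)

lemma inner_eq_dotProduct (u v : Feature d) : inner ℝ u v = v.ofLp ⬝ᵥ u.ofLp := by
  rw [EuclideanSpace.inner_eq_star_dotProduct, star_trivial]

lemma dotProduct_ofLp_self (v : Feature d) : v.ofLp ⬝ᵥ v.ofLp = ‖v‖ ^ 2 := by
  rw [← inner_eq_dotProduct, real_inner_self_eq_norm_sq]

variable {lam : ℝ}

lemma gram_zero (X : ℕ → Feature d) : gram lam X 0 = lam • 1 := by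
  simp only [gram, Finset.range_zero, Finset.sum_empty, add_zero]

lemma gram_succ (X : ℕ → Feature d) (t : ℕ) :
    gram lam X (t + 1) = gram lam X t + Matrix.vecMulVec (X t).ofLp (X t).ofLp := by
  rw [gram, gram, Finset.sum_range_succ, add_assoc]

lemma gram_sub_posSemidef (X : ℕ → Feature d) (t : ℕ) : (gram lam X t - lam • 1).PosSemidef := by
  rw [gram, add_sub_cancel_left]
  exact Matrix.posSemidef_sum _ fun s _ => by
    simpa only [star_trivial] using Matrix.posSemidef_vecMulVec_self_star (X s).ofLp

lemma gram_posDef (hlam : 0 < lam) (X : ℕ → Feature d) (t : ℕ) : (gram lam X t).PosDef := by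
  simpa only [sub_add_cancel] using
    Matrix.PosDef.posSemidef_add (gram_sub_posSemidef (lam := lam) X t)
      (Matrix.PosDef.one.smul hlam)

lemma isUnit_det_gram (hlam : 0 < lam) (X : ℕ → Feature d) (t : ℕ) : IsUnit (gram lam X t).det :=
  (gram_posDef hlam X t).det_pos.ne'.isUnit

lemma sq_wnorm_gram_inv (hlam : 0 < lam) (X : ℕ → Feature d) (t : ℕ) (v : Feature d) :
    wnorm (gram lam X t)⁻¹ v ^ 2 = v.ofLp ⬝ᵥ (gram lam X t)⁻¹ *ᵥ v.ofLp :=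
  sq_wnorm (gram_posDef hlam X t).inv.posSemidef v

lemma wnorm_gram_inv_le (hlam : 0 < lam) (X : ℕ → Feature d) (t : ℕ) (v : Feature d) :
    wnorm (gram lam X t)⁻¹ v ≤ ‖v‖ / √lam := by
  rw [wnorm, ← Real.sqrt_sq (norm_nonneg v), ← Real.sqrt_div (sq_nonneg _),
    ← dotProduct_ofLp_self]
  exact Real.sqrt_le_sqrt (dotProduct_inv_mulVec_le_div hlam (gram_sub_posSemidef X t) _)

lemma trace_gram (X : ℕ → Feature d) (t : ℕ) :
    (gram lam X t).trace = d * lam + ∑ s ∈ Finset.range t, ‖X s‖ ^ 2 := by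
  simp only [gram, Matrix.trace_add, Matrix.trace_smul, Matrix.trace_one, Fintype.card_fin,
    smul_eq_mul, Matrix.trace_sum, Matrix.trace_vecMulVec, dotProduct_ofLp_self, mul_comm lam]

lemma log_det_gram_div_le (hlam : 0 < lam) {X : ℕ → Feature d} {L : ℝ} (hX : ∀ s, ‖X s‖ ≤ L)
    (t : ℕ) :
    Real.log ((gram lam X t).det / lam ^ d) ≤ d * Real.log (1 + t * L ^ 2 / (d * lam)) := by
  rcases d.eq_zero_or_pos with rfl | hd
  · simp
  have hA := gram_posDef hlam X t
  have hpos := hA.det_pos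
  have hd' : (0 : ℝ) < d := Nat.cast_pos.2 hd
  have htrace : (gram lam X t).trace ≤ d * lam + t * L ^ 2 := by
    rw [trace_gram]
    gcongr
    simpa using Finset.sum_le_card_nsmul (Finset.range t) (fun s => ‖X s‖ ^ 2) (L ^ 2)
      fun s _ => pow_le_pow_left₀ (norm_nonneg _) (hX s) 2
  have hdet : (gram lam X t).det ≤ ((1 + t * L ^ 2 / (d * lam)) * lam) ^ d := by
    refine (det_le_trace_div_card_pow hA.posSemidef).trans ?_
    rw [Fintype.card_fin]
    refine pow_le_pow_left₀ (div_nonneg hA.posSemidef.trace_nonneg hd'.le) ?_ d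
    calc (gram lam X t).trace / d ≤ (d * lam + t * L ^ 2) / d := by gcongr
      _ = (1 + t * L ^ 2 / (d * lam)) * lam := by field_simp
  rw [← Real.log_pow]
  refine Real.log_le_log (by positivity) ?_
  rwa [div_le_iff₀ (by positivity), ← mul_pow]

lemma det_gram_succ (hlam : 0 < lam) (X : ℕ → Feature d) (t : ℕ) :
    (gram lam X (t + 1)).det =
      (gram lam X t).det * (1 + wnorm (gram lam X t)⁻¹ (X t) ^ 2) := by
  rw [gram_succ, det_add_vecMulVec (isUnit_det_gram hlam X t), sq_wnorm_gram_inv hlam]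

lemma min_one_le_two_mul_log_one_add {q : ℝ} (hq : 0 ≤ q) : min 1 q ≤ 2 * Real.log (1 + q) := by
  have hm : 0 ≤ min 1 q := le_min zero_le_one hq
  have hlog : 2 * min 1 q / (min 1 q + 2) ≤ Real.log (1 + q) :=
    (Real.le_log_one_add_of_nonneg hm).trans (Real.log_le_log (by linarith) (by simp))
  calc min 1 q ≤ 2 * (2 * min 1 q / (min 1 q + 2)) := by
        rw [← mul_div_assoc, le_div_iff₀ (by linarith)]
        nlinarith [min_le_left 1 q]
    _ ≤ 2 * Real.log (1 + q) := by gcongr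

lemma sum_min_one_sq_wnorm_le (hlam : 0 < lam) (X : ℕ → Feature d) (t : ℕ) :
    ∑ s ∈ Finset.range t, min 1 (wnorm (gram lam X s)⁻¹ (X s) ^ 2)
      ≤ 2 * Real.log ((gram lam X t).det / lam ^ d) := by
  induction t with
  | zero => simp [gram_zero, hlam.ne']
  | succ t ih =>
    have hpos := (gram_posDef hlam X t).det_pos
    rw [Finset.sum_range_succ, det_gram_succ hlam, mul_div_right_comm,
      Real.log_mul (by positivity) (by positivity)]
    linarith [min_one_le_two_mul_log_one_add (sq_nonneg (wnorm (gram lam X t)⁻¹ (X t)))]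

lemma log_det_gram_div_nonneg (hlam : 0 < lam) (X : ℕ → Feature d) (t : ℕ) :
    0 ≤ Real.log ((gram lam X t).det / lam ^ d) := by
  have hsum : 0 ≤ ∑ s ∈ Finset.range t, min 1 (wnorm (gram lam X s)⁻¹ (X s) ^ 2) :=
    Finset.sum_nonneg fun s _ => le_min zero_le_one (sq_nonneg _)
  linarith [sum_min_one_sq_wnorm_le hlam X t]

lemma sum_min_one_wnorm_le (hlam : 0 < lam) {X : ℕ → Feature d} {L : ℝ} (hX : ∀ s, ‖X s‖ ≤ L)
    (t : ℕ) :
    ∑ s ∈ Finset.range t, min 1 (wnorm (gram lam X s)⁻¹ (X s))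
      ≤ √t * √(2 * (d * Real.log (1 + t * L ^ 2 / (d * lam)))) := by
  rw [← Real.sqrt_mul (Nat.cast_nonneg t)]
  refine Real.le_sqrt_of_sq_le ?_
  calc (∑ s ∈ Finset.range t, min 1 (wnorm (gram lam X s)⁻¹ (X s))) ^ 2
      ≤ t * ∑ s ∈ Finset.range t, min 1 (wnorm (gram lam X s)⁻¹ (X s)) ^ 2 := by
        simpa only [Finset.card_range] using sq_sum_le_card_mul_sum_sq
          (s := Finset.range t) (f := fun s => min 1 (wnorm (gram lam X s)⁻¹ (X s)))
    _ ≤ t * ∑ s ∈ Finset.range t, min 1 (wnorm (gram lam X s)⁻¹ (X s) ^ 2) := by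
        gcongr with s
        have hm : 0 ≤ min 1 (wnorm (gram lam X s)⁻¹ (X s)) := le_min zero_le_one (wnorm_nonneg _ _)
        exact le_min (pow_le_one₀ hm (min_le_left _ _)) (pow_le_pow_left₀ hm (min_le_right _ _) 2)
    _ ≤ t * (2 * (d * Real.log (1 + t * L ^ 2 / (d * lam)))) := by
        gcongr
        linarith [sum_min_one_sq_wnorm_le hlam X t, log_det_gram_div_le hlam hX t]

end Gram

/-! ### Conditionally sub-Gaussian noise -/

section SubGaussian

variable {Ω : Type*} {m mΩ : MeasurableSpace Ω} {μ : Measure Ω} {η : Ω → ℝ}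

lemma CondSubGaussian.aemeasurable (hη : CondSubGaussian μ m η) : AEMeasurable η μ :=
  Real.aemeasurable_of_aemeasurable_exp (by simpa only [one_mul] using (hη 1).1.aemeasurable)

lemma CondSubGaussian.integrable (hη : CondSubGaussian μ m η) : Integrable η μ := by
  have huniv : integrableExpSet η μ = Set.univ := Set.eq_univ_of_forall fun z => (hη z).1
  exact memLp_one_iff_integrable.1
    (memLp_of_mem_interior_integrableExpSet (by simp [huniv]) 1)

lemma CondSubGaussian.setIntegral_exp_le [IsFiniteMeasure μ] (hm : m ≤ mΩ)
    (hη : CondSubGaussian μ m η) (z : ℝ) {s : Set Ω} (hs : MeasurableSet[m] s) :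
    ∫ ω in s, Real.exp (z * η ω) ∂μ ≤ Real.exp (z ^ 2 / 2) * μ.real s := by
  obtain ⟨hint, hle⟩ := hη z
  rw [← setIntegral_condExp hm hint hs]
  refine (setIntegral_mono_ae integrable_condExp.integrableOn
    (integrable_const (Real.exp (z ^ 2 / 2))).integrableOn hle).trans_eq ?_
  rw [setIntegral_const, smul_eq_mul, mul_comm]

section Select

variable {ι : Type*} [Countable ι] {ξ : ι → Ω → ℝ} {sel : Ω → ι}

lemma CondSubGaussian.integrable_exp_select [IsFiniteMeasure μ] (hm : m ≤ mΩ)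
    (hξ : ∀ i, CondSubGaussian μ m (ξ i)) (hsel : ∀ i, MeasurableSet[m] {ω | sel ω = i}) (z : ℝ) :
    Integrable (fun ω => Real.exp (z * ξ (sel ω) ω)) μ := by
  have hcongr (i : ι) : Set.EqOn (fun ω => Real.exp (z * ξ (sel ω) ω))
      (fun ω => Real.exp (z * ξ i ω)) {ω | sel ω = i} := by
    rintro ω rfl
    rfl
  have hcover : ⋃ i, {ω | sel ω = i} = Set.univ := Set.iUnion_eq_univ_iff.2 fun ω => ⟨sel ω, rfl⟩
  have hdisj : Pairwise (Function.onFun Disjoint fun i => {ω | sel ω = i}) :=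
    fun i j hij => Set.disjoint_left.2 fun ω hi hj => hij (hi.symm.trans hj)
  have hsum : Summable fun i => μ.real {ω | sel ω = i} := by
    refine ENNReal.summable_toReal ?_
    rw [← measure_iUnion hdisj fun i => hm _ (hsel i)]
    exact measure_ne_top _ _
  rw [← integrableOn_univ, ← hcover]
  refine integrableOn_iUnion_of_summable_integral_norm (fun i => ?_) ?_
  · exact ((hξ i z).1.integrableOn).congr_fun (hcongr i).symm (hm _ (hsel i))
  · refine Summable.of_nonneg_of_le (fun i => integral_nonneg fun ω => norm_nonneg _)
      (fun i => ?_) (hsum.mul_left (Real.exp (z ^ 2 / 2)))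
    simp only [Real.norm_eq_abs, Real.abs_exp]
    rw [setIntegral_congr_fun (hm _ (hsel i)) (hcongr i)]
    exact (hξ i).setIntegral_exp_le hm z (hsel i)

lemma CondSubGaussian.select [IsFiniteMeasure μ] (hm : m ≤ mΩ)
    (hξ : ∀ i, CondSubGaussian μ m (ξ i)) (hsel : ∀ i, MeasurableSet[m] {ω | sel ω = i}) :
    CondSubGaussian μ m fun ω => ξ (sel ω) ω := by
  intro z
  have hint := CondSubGaussian.integrable_exp_select hm hξ hsel z
  refine ⟨hint, ?_⟩
  have hcond (i : ι) : ∀ᵐ ω ∂μ, sel ω = i →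
      (μ[fun ω => Real.exp (z * ξ (sel ω) ω)|m]) ω = (μ[fun ω => Real.exp (z * ξ i ω)|m]) ω := by
    have hind : {ω | sel ω = i}.indicator (fun ω => Real.exp (z * ξ (sel ω) ω))
        = {ω | sel ω = i}.indicator fun ω => Real.exp (z * ξ i ω) :=
      Set.indicator_congr fun ω (hω : sel ω = i) => by rw [hω]
    have hleft := condExp_indicator hint (hsel i)
    rw [hind] at hleft
    filter_upwards [hleft, condExp_indicator (hξ i z).1 (hsel i)] with ω h₁ h₂ hω
    have hmem : ω ∈ {ω | sel ω = i} := hω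
    rwa [h₂, Set.indicator_of_mem hmem, Set.indicator_of_mem hmem, eq_comm] at h₁
  filter_upwards [ae_all_iff.2 hcond, ae_all_iff.2 fun i => (hξ i z).2] with ω hω hle
  rw [hω _ rfl]
  exact hle _

end Select

lemma CondSubGaussian.hasSubgaussianMGF_condDistrib {β : Type*} [mβ : MeasurableSpace β]
    [IsFiniteMeasure μ] {X : Ω → β} (hX : Measurable X)
    (hη : CondSubGaussian μ (mβ.comap X) η) :
    Kernel.HasSubgaussianMGF id 1 (condDistrib η X μ) (μ.map X) := by
  refine Kernel.HasSubgaussianMGF.of_rat (fun z => ?_) fun z => ?_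
  · rw [condDistrib_comp_map hX.aemeasurable hη.aemeasurable,
      integrable_map_measure (by fun_prop) hη.aemeasurable]
    exact (hη z).1
  · refine ae_map_iff hX.aemeasurable ?_ |>.2 ?_
    · exact measurableSet_le (StronglyMeasurable.integral_kernel (by fun_prop)).measurable
        measurable_const
    · filter_upwards [(hη z).2, condExp_ae_eq_integral_condDistrib hX hη.aemeasurable
        (f := fun y => Real.exp (z * y)) (by fun_prop) (hη z).1] with ω hle heq
      rw [heq] at hle
      simpa [mgf] using hle

lemma integral_eq_zero_of_hasSubgaussianMGF {Y : Ω → ℝ} {c : ℝ≥0} [IsProbabilityMeasure μ]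
    (hY : HasSubgaussianMGF Y c μ) : ∫ ω, Y ω ∂μ = 0 := by
  have hmgf : HasDerivAt (mgf Y μ) (∫ ω, Y ω ∂μ) 0 := by
    simpa using hasDerivAt_mgf (t := 0) (X := Y) (μ := μ) (by simp [hY.integrableExpSet_eq_univ])
  have hexp : HasDerivAt (fun z : ℝ => Real.exp (c * z ^ 2 / 2)) 0 0 := by
    have hsq : HasDerivAt (fun z : ℝ => c * z ^ 2 / 2) 0 0 := by
      simpa using ((hasDerivAt_pow 2 (0 : ℝ)).const_mul (c : ℝ)).div_const 2
    simpa using hsq.exp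
  have hmin : IsLocalMin (fun z => Real.exp (c * z ^ 2 / 2) - mgf Y μ z) 0 :=
    Filter.Eventually.of_forall fun z => by simpa using hY.mgf_le z
  simpa using hmin.hasDerivAt_eq_zero (hexp.sub hmgf)

lemma CondSubGaussian.ae_hasSubgaussianMGF_condDistrib {β : Type*} [mβ : MeasurableSpace β]
    [IsFiniteMeasure μ] {X : Ω → β} (hX : Measurable X)
    (hη : CondSubGaussian μ (mβ.comap X) η) :
    ∀ᵐ b ∂μ.map X, HasSubgaussianMGF id 1 (condDistrib η X μ b) := by
  have hκ := hη.hasSubgaussianMGF_condDistrib hX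
  filter_upwards [hκ.ae_forall_integrable_exp_mul, hκ.mgf_le] with b hint hle
  exact ⟨hint, hle⟩

lemma CondSubGaussian.condExp_comap_ae_eq_zero {β : Type*} [mβ : MeasurableSpace β]
    [IsFiniteMeasure μ] {X : Ω → β} (hX : Measurable X)
    (hη : CondSubGaussian μ (mβ.comap X) η) : μ[η|mβ.comap X] =ᵐ[μ] 0 := by
  filter_upwards [condExp_ae_eq_integral_condDistrib' hX hη.integrable,
    ae_of_ae_map hX.aemeasurable (hη.ae_hasSubgaussianMGF_condDistrib hX)] with ω hω hlaw
  rw [hω]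
  exact integral_eq_zero_of_hasSubgaussianMGF hlaw

lemma CondSubGaussian.condExp_ae_eq_zero [IsFiniteMeasure μ] (hm : m ≤ mΩ)
    (hη : CondSubGaussian μ m η) : μ[η|m] =ᵐ[μ] 0 := by
  rw [← @MeasurableSpace.comap_id _ m] at hη ⊢
  exact CondSubGaussian.condExp_comap_ae_eq_zero (mβ := m) (measurable_id'' hm) hη

end SubGaussian

/-! ### The method of mixtures -/

section Mixture

/-- The factor by which a Gaussian mixture of exponentials grows in one round: `η` is the noise of
the round, `u` the current prediction `xᵀ A⁻¹ z`, where `z` is the noise-weighted sum of the past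
features, and `q` the squared confidence width `xᵀ A⁻¹ x`. -/
noncomputable def mixtureStep (u q η : ℝ) : ℝ :=
  Real.exp ((2 * η * u + η ^ 2 * q - u ^ 2) / (2 * (1 + q))) / √(1 + q)

@[fun_prop]
lemma measurable_mixtureStep {α : Type*} [MeasurableSpace α] {u q η : α → ℝ} (hu : Measurable u)
    (hq : Measurable q) (hη : Measurable η) :
    Measurable fun a => mixtureStep (u a) (q a) (η a) := by
  unfold mixtureStep
  fun_prop

lemma gaussianPDFReal_zero_one_mul_exp (a : ℝ) {q : ℝ≥0} (g : ℝ) :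
    gaussianPDFReal 0 1 g * Real.exp (a * g - q * g ^ 2 / 2)
      = Real.exp (a ^ 2 / (2 * (1 + q))) / √(1 + q)
        * gaussianPDFReal (a / (1 + q)) (1 / (1 + q)) g := by
  have hsquare : -(g - 0) ^ 2 / (2 * (1 : ℝ≥0)) + (a * g - q * g ^ 2 / 2)
      = a ^ 2 / (2 * (1 + q)) + -(g - a / (1 + q)) ^ 2 / (2 * ((1 / (1 + q) : ℝ≥0) : ℝ)) := by
    push_cast
    field_simp
    ring
  have hnorm : √(2 * Real.pi * ((1 / (1 + q) : ℝ≥0) : ℝ)) = √(2 * Real.pi) / √(1 + q) := by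
    rw [← Real.sqrt_div (by positivity)]
    push_cast
    ring_nf
  rw [gaussianPDFReal, gaussianPDFReal, mul_assoc, ← Real.exp_add, hsquare, hnorm, Real.exp_add]
  simp only [NNReal.coe_one, mul_one]
  field_simp

lemma lintegral_exp_gaussianReal (a : ℝ) (q : ℝ≥0) :
    ∫⁻ g, ENNReal.ofReal (Real.exp (a * g - q * g ^ 2 / 2)) ∂gaussianReal 0 1
      = ENNReal.ofReal (Real.exp (a ^ 2 / (2 * (1 + q))) / √(1 + q)) := by
  have hvar : 1 / (1 + q) ≠ 0 := by positivity
  rw [gaussianReal_of_var_ne_zero 0 one_ne_zero,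
    lintegral_withDensity_eq_lintegral_mul _ (measurable_gaussianPDF 0 1) (by fun_prop)]
  simp only [Pi.mul_apply, gaussianPDF, ← ENNReal.ofReal_mul (gaussianPDFReal_nonneg _ _ _),
    gaussianPDFReal_zero_one_mul_exp]
  have hpos : 0 ≤ Real.exp (a ^ 2 / (2 * (1 + q))) / √(1 + q) := by positivity
  simp only [ENNReal.ofReal_mul hpos]
  rw [lintegral_const_mul _ (by fun_prop), lintegral_gaussianPDFReal_eq_one _ hvar, mul_one]

lemma lintegral_exp_quadratic_gaussianReal (u η : ℝ) (q : ℝ≥0) :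
    ∫⁻ g, ENNReal.ofReal (Real.exp ((u + √q * g) * η - (u + √q * g) ^ 2 / 2)) ∂gaussianReal 0 1
      = ENNReal.ofReal (mixtureStep u q η) := by
  have hsq : √(q : ℝ) ^ 2 = q := Real.sq_sqrt q.coe_nonneg
  have hsplit (g : ℝ) : (u + √q * g) * η - (u + √q * g) ^ 2 / 2
      = (u * η - u ^ 2 / 2) + (√q * (η - u) * g - q * g ^ 2 / 2) := by
    linear_combination -(g ^ 2 / 2) * hsq
  simp only [hsplit, Real.exp_add, ENNReal.ofReal_mul (Real.exp_pos _).le]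
  rw [lintegral_const_mul _ (by fun_prop), lintegral_exp_gaussianReal,
    ← ENNReal.ofReal_mul (Real.exp_pos _).le, ← mul_div_assoc, ← Real.exp_add, mixtureStep,
    mul_pow, hsq]
  congr 3
  field_simp
  ring

-- Tonelli: the exponentials in `z = u + √q g` have mean at most one for each `g`.
lemma lintegral_mixtureStep_le_one {ν : Measure ℝ} [IsFiniteMeasure ν]
    (hν : HasSubgaussianMGF id 1 ν) (u : ℝ) (q : ℝ≥0) :
    ∫⁻ y, ENNReal.ofReal (mixtureStep u q y) ∂ν ≤ 1 := by
  have hexp (z : ℝ) : ∫⁻ y, ENNReal.ofReal (Real.exp (z * y - z ^ 2 / 2)) ∂ν ≤ 1 := by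
    have hmgf := hν.mgf_le z
    have hint := hν.integrable_exp_mul z
    simp only [mgf, id_eq, NNReal.coe_one, one_mul] at hmgf hint
    simp only [Real.exp_sub, div_eq_mul_inv (Real.exp _)]
    rw [← ofReal_integral_eq_lintegral_ofReal (hint.mul_const _)
        (ae_of_all _ fun y => mul_nonneg (Real.exp_pos _).le (by positivity)),
      ENNReal.ofReal_le_one, integral_mul_const, ← div_eq_mul_inv, div_le_one (Real.exp_pos _)]
    exact hmgf
  simp only [← lintegral_exp_quadratic_gaussianReal]
  rw [lintegral_lintegral_swap (by fun_prop)]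
  calc ∫⁻ g, ∫⁻ y, ENNReal.ofReal (Real.exp ((u + √q * g) * y - (u + √q * g) ^ 2 / 2)) ∂ν
        ∂gaussianReal 0 1
      ≤ ∫⁻ _, 1 ∂gaussianReal 0 1 := lintegral_mono fun g => hexp _
    _ = 1 := by simp

lemma lintegral_mul_mixtureStep_comp_le {Ω β : Type*} [MeasurableSpace Ω] [mβ : MeasurableSpace β]
    {μ : Measure Ω} [IsFiniteMeasure μ] {X : Ω → β} (hX : Measurable X) {η : Ω → ℝ}
    (hη : CondSubGaussian μ (mβ.comap X) η) {Y : β → ℝ≥0∞} (hY : Measurable Y) {u : β → ℝ}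
    (hu : Measurable u) {q : β → ℝ≥0} (hq : Measurable q) :
    ∫⁻ ω, Y (X ω) * ENNReal.ofReal (mixtureStep (u (X ω)) (q (X ω)) (η ω)) ∂μ
      ≤ ∫⁻ ω, Y (X ω) ∂μ := by
  have hηm := hη.aemeasurable
  have hf : Measurable fun p : β × ℝ =>
      Y p.1 * ENNReal.ofReal (mixtureStep (u p.1) (q p.1) p.2) := by
    fun_prop
  calc ∫⁻ ω, Y (X ω) * ENNReal.ofReal (mixtureStep (u (X ω)) (q (X ω)) (η ω)) ∂μ
      = ∫⁻ b, ∫⁻ y, Y b * ENNReal.ofReal (mixtureStep (u b) (q b) y) ∂condDistrib η X μ b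
          ∂μ.map X := by
        rw [← Measure.lintegral_compProd hf, compProd_map_condDistrib hηm,
          lintegral_map' hf.aemeasurable (by fun_prop)]
    _ ≤ ∫⁻ b, Y b ∂μ.map X := by
        refine lintegral_mono_ae ?_
        filter_upwards [hη.ae_hasSubgaussianMGF_condDistrib hX] with b hb
        rw [lintegral_const_mul _ (by fun_prop)]
        exact mul_le_of_le_one_right' (lintegral_mixtureStep_le_one hb _ _)
    _ = ∫⁻ ω, Y (X ω) ∂μ := lintegral_map hY hX

lemma lintegral_mul_mixtureStep_le {Ω : Type*} {m mΩ : MeasurableSpace Ω} {μ : Measure Ω}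
    [IsFiniteMeasure μ] (hm : m ≤ mΩ) {η : Ω → ℝ} (hη : CondSubGaussian μ m η) {Y : Ω → ℝ≥0∞}
    (hY : Measurable[m] Y) {u : Ω → ℝ} (hu : Measurable[m] u) {q : Ω → ℝ≥0} (hq : Measurable[m] q) :
    ∫⁻ ω, Y ω * ENNReal.ofReal (mixtureStep (u ω) (q ω) (η ω)) ∂μ ≤ ∫⁻ ω, Y ω ∂μ := by
  rw [← @MeasurableSpace.comap_id _ m] at hη
  exact lintegral_mul_mixtureStep_comp_le (mβ := m) (X := id) (measurable_id'' hm) hη hY hu hq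

end Mixture

section Ville

variable {Ω : Type*} {mΩ : MeasurableSpace Ω} {μ : Measure Ω}

lemma mul_measure_union_add_setLIntegral_compl_le {f : Ω → ℝ≥0∞} (hf : Measurable f) {H : Set Ω}
    (hH : MeasurableSet H) (K : ℝ≥0∞) :
    K * μ (H ∪ {ω | K ≤ f ω}) + ∫⁻ ω in (H ∪ {ω | K ≤ f ω})ᶜ, f ω ∂μ
      ≤ K * μ H + ∫⁻ ω in Hᶜ, f ω ∂μ := by
  have hlevel : MeasurableSet {ω | K ≤ f ω} := hf measurableSet_Ici
  have hmarkov : K * μ (Hᶜ ∩ {ω | K ≤ f ω}) ≤ ∫⁻ ω in Hᶜ ∩ {ω | K ≤ f ω}, f ω ∂μ := by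
    rw [← setLIntegral_const]
    exact setLIntegral_mono hf fun ω hω => hω.2
  have hunion : μ (H ∪ {ω | K ≤ f ω}) = μ H + μ (Hᶜ ∩ {ω | K ≤ f ω}) := by
    rw [← measure_union (disjoint_compl_right.mono_right Set.inter_subset_left)
      (hH.compl.inter hlevel), Set.union_inter_distrib_left, Set.union_compl_self, Set.univ_inter]
  have hsplit : ∫⁻ ω in Hᶜ, f ω ∂μ = ∫⁻ ω in Hᶜ ∩ {ω | K ≤ f ω}, f ω ∂μ
      + ∫⁻ ω in (H ∪ {ω | K ≤ f ω})ᶜ, f ω ∂μ := by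
    rw [Set.compl_union, ← Set.sdiff_eq, lintegral_inter_add_sdiff _ _ hlevel]
  rw [hunion, hsplit, mul_add, ← add_assoc]
  gcongr

lemma mul_measure_exists_le_of_supermartingale (F : Filtration ℕ mΩ) {W : ℕ → Ω → ℝ≥0∞}
    (hW : ∀ t, Measurable[F t] (W t))
    (hstep : ∀ t s, MeasurableSet[F t] s → ∫⁻ ω in s, W (t + 1) ω ∂μ ≤ ∫⁻ ω in s, W t ω ∂μ)
    (K : ℝ≥0∞) (t : ℕ) :
    K * μ {ω | ∃ s < t, K ≤ W s ω} ≤ ∫⁻ ω, W 0 ω ∂μ := by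
  let H (t : ℕ) : Set Ω := {ω | ∃ s < t, K ≤ W s ω}
  have hsucc (t : ℕ) : H (t + 1) = H t ∪ {ω | K ≤ W t ω} :=
    Set.ext fun ω => Nat.exists_lt_succ_right
  have hH (t : ℕ) : MeasurableSet[F t] (H t) := by
    induction t with
    | zero => simp [H]
    | succ t ih =>
      rw [hsucc]
      exact F.mono (Nat.le_succ t) _ (ih.union (hW t measurableSet_Ici))
  suffices hstopped : K * μ (H t) + ∫⁻ ω in (H t)ᶜ, W t ω ∂μ ≤ ∫⁻ ω, W 0 ω ∂μ from
    le_self_add.trans hstopped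
  induction t with
  | zero => simp [H]
  | succ t ih =>
    refine le_trans ?_ ih
    rw [hsucc]
    refine le_trans ?_ (mul_measure_union_add_setLIntegral_compl_le ((hW t).mono (F.le t) le_rfl)
      (F.le t _ (hH t)) K)
    exact add_le_add_right (hstep t _ ((hH t).union (hW t measurableSet_Ici)).compl) _

end Ville

/-! ### The self-normalized confidence bound -/

section Ridge

variable {d : ℕ} {lam : ℝ}

lemma bvec_succ (X : ℕ → Feature d) (R : ℕ → ℝ) (t : ℕ) :
    bvec X R (t + 1) = bvec X R t + R t • X t :=
  Finset.sum_range_succ _ t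

lemma bvec_ofLp_eq_noise_add {X : ℕ → Feature d} {R E : ℕ → ℝ} {θ : Feature d}
    (hR : ∀ s, R s = inner ℝ θ (X s) + E s) (t : ℕ) :
    (bvec X R t).ofLp = (bvec X E t).ofLp + gram lam X t *ᵥ θ.ofLp - lam • θ.ofLp := by
  induction t with
  | zero => simp [bvec, gram_zero, Matrix.smul_mulVec]
  | succ t ih =>
    rw [bvec_succ, bvec_succ, gram_succ, Matrix.add_mulVec, Matrix.vecMulVec_mulVec, hR,
      inner_eq_dotProduct, WithLp.ofLp_add, WithLp.ofLp_add, WithLp.ofLp_smul, WithLp.ofLp_smul, ih,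
      op_smul_eq_smul]
    module

lemma inner_ridge_sub_inner (hlam : 0 < lam) {X : ℕ → Feature d} {R E : ℕ → ℝ} {θ : Feature d}
    (hR : ∀ s, R s = inner ℝ θ (X s) + E s) (t : ℕ) (x : Feature d) :
    inner ℝ (ridge lam X R t) x - inner ℝ θ x
      = x.ofLp ⬝ᵥ (gram lam X t)⁻¹ *ᵥ (bvec X E t).ofLp
        - lam * (x.ofLp ⬝ᵥ (gram lam X t)⁻¹ *ᵥ θ.ofLp) := by
  have hA := isUnit_det_gram hlam X t
  rw [inner_eq_dotProduct, inner_eq_dotProduct, ridge, bvec_ofLp_eq_noise_add (lam := lam) hR,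
    Matrix.mulVec_sub, Matrix.mulVec_add, inv_mulVec_mulVec hA, Matrix.mulVec_smul,
    dotProduct_sub, dotProduct_add, dotProduct_smul, smul_eq_mul]
  ring

/-- The Gaussian mixture `(|λ I| / |A_t|)^{1/2} exp(‖Z_t‖²_{A_t⁻¹} / 2)` of the exponential
supermartingales of the noise `E`, with `Z_t = ∑_{s<t} E_s x_s`. -/
noncomputable def mixture (lam : ℝ) (X : ℕ → Feature d) (E : ℕ → ℝ) (t : ℕ) : ℝ :=
  √(lam ^ d / (gram lam X t).det) * Real.exp (wnorm (gram lam X t)⁻¹ (bvec X E t) ^ 2 / 2)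

lemma mixture_nonneg (lam : ℝ) (X : ℕ → Feature d) (E : ℕ → ℝ) (t : ℕ) : 0 ≤ mixture lam X E t :=
  mul_nonneg (Real.sqrt_nonneg _) (Real.exp_pos _).le

lemma mixture_zero (hlam : 0 < lam) (X : ℕ → Feature d) (E : ℕ → ℝ) : mixture lam X E 0 = 1 := by
  simp [mixture, bvec, wnorm, gram_zero, hlam.ne']

lemma mixture_succ (hlam : 0 < lam) (X : ℕ → Feature d) (E : ℕ → ℝ) (t : ℕ) :
    mixture lam X E (t + 1) = mixture lam X E t *
      mixtureStep ((X t).ofLp ⬝ᵥ (gram lam X t)⁻¹ *ᵥ (bvec X E t).ofLp)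
        (wnorm (gram lam X t)⁻¹ (X t) ^ 2) (E t) := by
  have hA := gram_posDef hlam X t
  have hdet := hA.det_pos
  have hwidth := sq_wnorm hA.posSemidef.inv (X t)
  have hexp : wnorm (gram lam X (t + 1))⁻¹ (bvec X E (t + 1)) ^ 2 / 2
      = wnorm (gram lam X t)⁻¹ (bvec X E t) ^ 2 / 2
        + (2 * E t * ((X t).ofLp ⬝ᵥ (gram lam X t)⁻¹ *ᵥ (bvec X E t).ofLp)
          + E t ^ 2 * wnorm (gram lam X t)⁻¹ (X t) ^ 2
          - ((X t).ofLp ⬝ᵥ (gram lam X t)⁻¹ *ᵥ (bvec X E t).ofLp) ^ 2)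
          / (2 * (1 + wnorm (gram lam X t)⁻¹ (X t) ^ 2)) := by
    rw [sq_wnorm (gram_posDef hlam X (t + 1)).posSemidef.inv, sq_wnorm hA.posSemidef.inv, gram_succ,
      bvec_succ, WithLp.ofLp_add, WithLp.ofLp_smul,
      dotProduct_inv_add_vecMulVec_mulVec hA.det_pos.ne'.isUnit hA.isHermitian
        (by rw [← hwidth]; positivity), hwidth, add_div, div_div, mul_comm (2 : ℝ) (1 + _)]
  rw [mixture, mixture, hexp, det_gram_succ hlam, ← div_div, Real.sqrt_div (by positivity),
    Real.exp_add, mixtureStep]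
  ring

lemma wnorm_bvec_le_of_mixture_lt (hlam : 0 < lam) {δ : ℝ} {X : ℕ → Feature d} {E : ℕ → ℝ} {t : ℕ}
    (hmix : mixture lam X E t < δ⁻¹) :
    wnorm (gram lam X t)⁻¹ (bvec X E t)
      ≤ √(2 * Real.log (√(gram lam X t).det
        * (√(lam • (1 : Matrix (Fin d) (Fin d) ℝ)).det)⁻¹ * δ⁻¹)) := by
  have hdet := (gram_posDef hlam X t).det_pos
  have hexp : Real.exp (wnorm (gram lam X t)⁻¹ (bvec X E t) ^ 2 / 2)
      ≤ √(gram lam X t).det * (√(lam ^ d))⁻¹ * δ⁻¹ := by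
    calc Real.exp (wnorm (gram lam X t)⁻¹ (bvec X E t) ^ 2 / 2)
        = √(gram lam X t).det * (√(lam ^ d))⁻¹ * mixture lam X E t := by
          rw [mixture, Real.sqrt_div (by positivity)]
          field_simp
      _ ≤ √(gram lam X t).det * (√(lam ^ d))⁻¹ * δ⁻¹ := by gcongr
  have hlog := (Real.le_log_iff_exp_le ((Real.exp_pos _).trans_le hexp)).2 hexp
  refine Real.le_sqrt_of_sq_le ?_
  rw [Matrix.det_smul, Matrix.det_one, mul_one, Fintype.card_fin]
  linarith

lemma mul_wnorm_gram_inv_le (hlam : 0 < lam) (X : ℕ → Feature d) (t : ℕ) (θ : Feature d) :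
    lam * wnorm (gram lam X t)⁻¹ θ ≤ √lam * ‖θ‖ :=
  calc lam * wnorm (gram lam X t)⁻¹ θ
      ≤ lam * (‖θ‖ / √lam) := by gcongr; exact wnorm_gram_inv_le hlam X t θ
    _ = √lam * ‖θ‖ := by rw [mul_div_left_comm, Real.div_sqrt, mul_comm]

lemma abs_inner_ridge_sub_le (hlam : 0 < lam) {δ : ℝ} {X : ℕ → Feature d} {R E : ℕ → ℝ}
    {θ : Feature d} (hR : ∀ s, R s = inner ℝ θ (X s) + E s) {t : ℕ}
    (hmix : mixture lam X E t < δ⁻¹) (x : Feature d) :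
    |inner ℝ (ridge lam X R t) x - inner ℝ θ x|
      ≤ confRadius lam δ θ X t * wnorm (gram lam X t)⁻¹ x := by
  have hA := (gram_posDef hlam X t).posSemidef.inv
  have hx := wnorm_nonneg (gram lam X t)⁻¹ x
  calc |inner ℝ (ridge lam X R t) x - inner ℝ θ x|
      ≤ |x.ofLp ⬝ᵥ (gram lam X t)⁻¹ *ᵥ (bvec X E t).ofLp|
        + lam * |x.ofLp ⬝ᵥ (gram lam X t)⁻¹ *ᵥ θ.ofLp| := by
        rw [inner_ridge_sub_inner hlam hR]
        exact (abs_sub _ _).trans_eq (by rw [abs_mul, abs_of_pos hlam])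
    _ ≤ wnorm (gram lam X t)⁻¹ x * wnorm (gram lam X t)⁻¹ (bvec X E t)
        + lam * (wnorm (gram lam X t)⁻¹ x * wnorm (gram lam X t)⁻¹ θ) := by
        gcongr <;> exact abs_dotProduct_mulVec_le_wnorm_mul_wnorm hA _ _
    _ = (lam * wnorm (gram lam X t)⁻¹ θ + wnorm (gram lam X t)⁻¹ (bvec X E t))
        * wnorm (gram lam X t)⁻¹ x := by ring
    _ ≤ confRadius lam δ θ X t * wnorm (gram lam X t)⁻¹ x :=
        mul_le_mul_of_nonneg_right (add_le_add (mul_wnorm_gram_inv_le hlam X t θ)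
          (wnorm_bvec_le_of_mixture_lt hlam hmix)) hx

end Ridge

section Measurability

variable {Ω : Type*} {mΩ : MeasurableSpace Ω}

lemma measurable_select {ι β : Type*} [Countable ι] [MeasurableSpace β] {sel : Ω → ι}
    (hsel : ∀ i, MeasurableSet {ω | sel ω = i}) {f : ι → Ω → β} (hf : ∀ i, Measurable (f i)) :
    Measurable fun ω => f (sel ω) ω := by
  let _ : MeasurableSpace ι := ⊤
  have hsel' : Measurable sel := measurable_to_countable' hsel
  exact (measurable_from_prod_countable_right (f := fun p : ι × Ω => f p.1 p.2) hf).comp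
    (hsel'.prodMk measurable_id)

lemma measurable_det {n : Type*} [Fintype n] [DecidableEq n] {A : Ω → Matrix n n ℝ}
    (hA : ∀ i j, Measurable fun ω => A ω i j) : Measurable fun ω => (A ω).det := by
  simp only [Matrix.det_apply']
  fun_prop

lemma measurable_inv_apply {n : Type*} [Fintype n] [DecidableEq n] {A : Ω → Matrix n n ℝ}
    (hA : ∀ i j, Measurable fun ω => A ω i j) (i j : n) :
    Measurable fun ω => (A ω)⁻¹ i j := by
  simp only [Matrix.inv_def, Matrix.smul_apply, Ring.inverse_eq_inv', smul_eq_mul,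
    Matrix.adjugate_apply]
  refine (measurable_det hA).inv.mul (measurable_det fun k l => ?_)
  simp only [Matrix.updateRow_apply]
  split_ifs
  · exact measurable_const
  · exact hA _ _

lemma measurable_dotProduct_mulVec {m n : Type*} [Fintype m] [Fintype n] {A : Ω → Matrix m n ℝ}
    {u : Ω → m → ℝ} {v : Ω → n → ℝ} (hA : ∀ i j, Measurable fun ω => A ω i j) (hu : Measurable u)
    (hv : Measurable v) : Measurable fun ω => u ω ⬝ᵥ A ω *ᵥ v ω := by
  simp only [dotProduct, Matrix.mulVec]
  fun_prop

variable {d t : ℕ} {lam : ℝ} {X : Ω → ℕ → Feature d} {E : Ω → ℕ → ℝ}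

lemma measurable_wnorm {A : Ω → Matrix (Fin d) (Fin d) ℝ} {v : Ω → Feature d}
    (hA : ∀ i j, Measurable fun ω => A ω i j) (hv : Measurable v) :
    Measurable fun ω => wnorm (A ω) (v ω) :=
  (measurable_dotProduct_mulVec hA (by fun_prop) (by fun_prop)).sqrt

lemma measurable_gram_apply (hX : ∀ s < t, Measurable fun ω => X ω s) (i j : Fin d) :
    Measurable fun ω => gram lam (X ω) t i j := by
  simp only [gram, Matrix.add_apply, Matrix.sum_apply, Matrix.vecMulVec_apply]
  refine measurable_const.add (Finset.measurable_sum _ fun s hs => ?_)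
  have := hX s (Finset.mem_range.1 hs)
  fun_prop

lemma measurable_bvec (hX : ∀ s < t, Measurable fun ω => X ω s)
    (hE : ∀ s < t, Measurable fun ω => E ω s) : Measurable fun ω => bvec (X ω) (E ω) t :=
  Finset.measurable_sum _ fun s hs =>
    (hE s (Finset.mem_range.1 hs)).smul (hX s (Finset.mem_range.1 hs))

lemma measurable_mixture (hX : ∀ s < t, Measurable fun ω => X ω s)
    (hE : ∀ s < t, Measurable fun ω => E ω s) :
    Measurable fun ω => mixture lam (X ω) (E ω) t := by
  have hgram := measurable_gram_apply (lam := lam) hX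
  exact (measurable_const.div (measurable_det hgram)).sqrt.mul
    (((measurable_wnorm (measurable_inv_apply hgram) (measurable_bvec hX hE)).pow_const 2).div_const
      2).exp

end Measurability

section SelfNormalized

variable {Ω : Type*} {mΩ : MeasurableSpace Ω} {μ : Measure Ω} {F : Filtration ℕ mΩ} {d : ℕ}
  {lam : ℝ} {X : Ω → ℕ → Feature d} {E : Ω → ℕ → ℝ}

lemma measurable_mixture_filtration (hX : ∀ t, Measurable[F t] fun ω => X ω t)
    (hE : ∀ t, Measurable[F (t + 1)] fun ω => E ω t) (t : ℕ) :
    Measurable[F t] fun ω => mixture lam (X ω) (E ω) t :=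
  measurable_mixture (mΩ := F t) (fun s hs => (hX s).mono (F.mono hs.le) le_rfl)
    fun s hs => (hE s).mono (F.mono hs) le_rfl

lemma setLIntegral_mixture_succ_le [IsFiniteMeasure μ] (hlam : 0 < lam)
    (hX : ∀ t, Measurable[F t] fun ω => X ω t) (hE : ∀ t, Measurable[F (t + 1)] fun ω => E ω t)
    {t : ℕ} (hsub : CondSubGaussian μ (F t) fun ω => E ω t) {s : Set Ω}
    (hs : MeasurableSet[F t] s) :
    ∫⁻ ω in s, ENNReal.ofReal (mixture lam (X ω) (E ω) (t + 1)) ∂μ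
      ≤ ∫⁻ ω in s, ENNReal.ofReal (mixture lam (X ω) (E ω) t) ∂μ := by
  have hXpast (s : ℕ) (hs : s < t) : Measurable[F t] fun ω => X ω s :=
    (hX s).mono (F.mono hs.le) le_rfl
  have hEpast (s : ℕ) (hs : s < t) : Measurable[F t] fun ω => E ω s :=
    (hE s).mono (F.mono hs) le_rfl
  have hinv := measurable_inv_apply (measurable_gram_apply (lam := lam) hXpast)
  have hprediction : Measurable[F t] fun ω =>
      (X ω t).ofLp ⬝ᵥ (gram lam (X ω) t)⁻¹ *ᵥ (bvec (X ω) (E ω) t).ofLp :=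
    measurable_dotProduct_mulVec hinv ((WithLp.measurable_ofLp 2 _).comp (hX t))
      ((WithLp.measurable_ofLp 2 _).comp (measurable_bvec hXpast hEpast))
  have hwidth : Measurable[F t] fun ω => (wnorm (gram lam (X ω) t)⁻¹ (X ω t) ^ 2).toNNReal :=
    ((measurable_wnorm hinv (hX t)).pow_const 2).real_toNNReal
  have hmix := (measurable_mixture_filtration (lam := lam) hX hE t).ennreal_ofReal
  have hstep := lintegral_mul_mixtureStep_le (F.le t) hsub (hmix.indicator hs) hprediction hwidth
  rw [← lintegral_indicator (F.le t _ hs), ← lintegral_indicator (F.le t _ hs)]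
  refine le_of_eq_of_le (lintegral_congr fun ω => ?_) hstep
  rw [Real.coe_toNNReal _ (sq_nonneg _)]
  simp only [mixture_succ hlam, ENNReal.ofReal_mul (mixture_nonneg _ _ _ _)]
  exact Set.indicator_mul_left s _ _

lemma measureReal_exists_le_mixture_le [IsProbabilityMeasure μ] (hlam : 0 < lam)
    (hX : ∀ t, Measurable[F t] fun ω => X ω t) (hE : ∀ t, Measurable[F (t + 1)] fun ω => E ω t)
    (hsub : ∀ t, CondSubGaussian μ (F t) fun ω => E ω t) {K : ℝ} (hK : 0 < K) (t : ℕ) :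
    μ.real {ω | ∃ s < t, K ≤ mixture lam (X ω) (E ω) s} ≤ 1 / K := by
  have hville := mul_measure_exists_le_of_supermartingale (μ := μ) F
    (W := fun t ω => ENNReal.ofReal (mixture lam (X ω) (E ω) t))
    (fun t => (measurable_mixture_filtration hX hE t).ennreal_ofReal)
    (fun t s hs => setLIntegral_mixture_succ_le hlam hX hE (hsub t) hs) (ENNReal.ofReal K) t
  simp only [mixture_zero hlam, ENNReal.ofReal_one, lintegral_const, measure_univ, mul_one,
    ENNReal.ofReal_le_ofReal_iff (mixture_nonneg _ _ _ _)] at hville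
  have hreal := ENNReal.toReal_mono ENNReal.one_ne_top hville
  rw [ENNReal.toReal_mul, ENNReal.toReal_ofReal hK.le, ENNReal.toReal_one] at hreal
  rwa [le_div_iff₀' hK]

end SelfNormalized

/-! ### Rewards and noise along a predictable selection of arms -/

namespace Bandit

variable {d : ℕ} {Arm Ω : Type*} [mΩ : MeasurableSpace Ω] {B : Bandit d Arm Ω} {μ : Measure Ω}
  {L M : ℝ} {arm best : ℕ → Ω → Arm} {t : ℕ}

/-- The noise in the payoffs observed on the sample path `ω`. -/
noncomputable def pulledNoise (B : Bandit d Arm Ω) (arm : ℕ → Ω → Arm) (ω : Ω) (s : ℕ) : ℝ :=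
  B.noise s (arm s ω) ω

lemma payoff_eq_inner_add_pulledNoise (B : Bandit d Arm Ω) (arm : ℕ → Ω → Arm) (ω : Ω) (s : ℕ) :
    B.payoff arm ω s = inner ℝ B.θ (B.pulledX arm ω s) + B.pulledNoise arm ω s :=
  (add_sub_cancel _ _).symm

namespace Assumptions

lemma measurable_mean (h : B.Assumptions μ L M) (t : ℕ) (a : Arm) :
    Measurable[B.F t] (B.mean t a) :=
  (measurable_const (a := B.θ)).inner (h.x_predictable t a)

lemma integrable_reward [IsFiniteMeasure μ] (h : B.Assumptions μ L M) (t : ℕ) (a : Arm) :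
    Integrable (B.reward t a) μ :=
  .of_mem_Icc 0 1 (h.reward_measurable t a).aemeasurable (h.reward_mem t a)

lemma integrable_mean [IsFiniteMeasure μ] (h : B.Assumptions μ L M) (t : ℕ) (a : Arm) :
    Integrable (B.mean t a) μ :=
  ((h.integrable_reward t a).sub (h.noise_subGaussian t a).integrable).congr
    (ae_of_all _ fun _ => sub_sub_cancel _ _)

lemma mean_ae_eq_condExp_reward [IsFiniteMeasure μ] (h : B.Assumptions μ L M) (t : ℕ) (a : Arm) :
    B.mean t a =ᵐ[μ] μ[B.reward t a|B.F t] := by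
  have hnoise := h.noise_subGaussian t a
  have hdecomp : B.reward t a = B.noise t a + B.mean t a := by
    funext ω
    exact (sub_add_cancel _ _).symm
  rw [hdecomp]
  filter_upwards [condExp_add hnoise.integrable (h.integrable_mean t a) (B.F t),
    hnoise.condExp_ae_eq_zero (B.F.le t)] with ω hadd hzero
  rw [hadd, Pi.add_apply, hzero, condExp_of_stronglyMeasurable (B.F.le t)
    (h.measurable_mean t a).stronglyMeasurable (h.integrable_mean t a), Pi.zero_apply, zero_add]

lemma mean_mem_Icc [IsFiniteMeasure μ] (h : B.Assumptions μ L M) (t : ℕ) (a : Arm) :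
    ∀ᵐ ω ∂μ, B.mean t a ω ∈ Set.Icc (0 : ℝ) 1 := by
  have hnonneg : 0 ≤ᵐ[μ] μ[B.reward t a|B.F t] :=
    condExp_nonneg ((h.reward_mem t a).mono fun ω hω => hω.1)
  have hle : μ[B.reward t a|B.F t] ≤ᵐ[μ] μ[fun _ => (1 : ℝ)|B.F t] :=
    condExp_mono (h.integrable_reward t a) (integrable_const 1)
      ((h.reward_mem t a).mono fun ω hω => hω.2)
  rw [condExp_const (B.F.le t)] at hle
  filter_upwards [h.mean_ae_eq_condExp_reward t a, hnonneg, hle] with ω heq h0 h1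
  exact heq ▸ ⟨h0, h1⟩

variable [Countable Arm]

lemma ae_forall_reward_mem (h : B.Assumptions μ L M) :
    ∀ᵐ ω ∂μ, ∀ t a, B.reward t a ω ∈ Set.Icc (0 : ℝ) 1 :=
  ae_all_iff.2 fun t => ae_all_iff.2 fun a => h.reward_mem t a

lemma ae_forall_mean_mem [IsFiniteMeasure μ] (h : B.Assumptions μ L M) :
    ∀ᵐ ω ∂μ, ∀ t a, B.mean t a ω ∈ Set.Icc (0 : ℝ) 1 :=
  ae_all_iff.2 fun t => ae_all_iff.2 fun a => h.mean_mem_Icc t a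

lemma measurable_pulledX (h : B.Assumptions μ L M) (harm : B.Predictable arm) (t : ℕ) :
    Measurable[B.F t] fun ω => B.pulledX arm ω t :=
  measurable_select (mΩ := B.F t) (harm t) (h.x_predictable t)

lemma measurable_pulledNoise (h : B.Assumptions μ L M) (harm : B.Predictable arm)
    (hobs : Measurable[B.F (t + 1)] fun ω => B.payoff arm ω t) :
    Measurable[B.F (t + 1)] fun ω => B.pulledNoise arm ω t :=
  hobs.sub ((measurable_const (a := B.θ)).inner
    ((h.measurable_pulledX harm t).mono (B.F.mono t.le_succ) le_rfl))

lemma condSubGaussian_pulledNoise [IsFiniteMeasure μ] (h : B.Assumptions μ L M)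
    (harm : B.Predictable arm) (t : ℕ) :
    CondSubGaussian μ (B.F t) fun ω => B.pulledNoise arm ω t :=
  CondSubGaussian.select (B.F.le t) (h.noise_subGaussian t) (harm t)

lemma integrable_reward_select [IsFiniteMeasure μ] (h : B.Assumptions μ L M)
    (harm : B.Predictable arm) (t : ℕ) : Integrable (fun ω => B.reward t (arm t ω) ω) μ :=
  .of_mem_Icc 0 1
    (measurable_select (fun a => B.F.le t _ (harm t a)) (h.reward_measurable t)).aemeasurable
    (h.ae_forall_reward_mem.mono fun ω hω => hω t (arm t ω))

lemma integrable_mean_select [IsFiniteMeasure μ] (h : B.Assumptions μ L M)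
    (harm : B.Predictable arm) (t : ℕ) : Integrable (fun ω => B.mean t (arm t ω) ω) μ :=
  ((h.integrable_reward_select harm t).sub (h.condSubGaussian_pulledNoise harm t).integrable).congr
    (ae_of_all _ fun _ => sub_sub_cancel _ _)

lemma integral_reward_select [IsFiniteMeasure μ] (h : B.Assumptions μ L M)
    (harm : B.Predictable arm) (t : ℕ) :
    ∫ ω, B.reward t (arm t ω) ω ∂μ = ∫ ω, B.mean t (arm t ω) ω ∂μ := by
  have hnoise : ∫ ω, B.pulledNoise arm ω t ∂μ = 0 := by
    rw [← integral_condExp (B.F.le t), integral_congr_ae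
      ((h.condSubGaussian_pulledNoise harm t).condExp_ae_eq_zero (B.F.le t))]
    exact integral_zero _ _
  simp only [pulledNoise, noise] at hnoise
  rwa [integral_sub (h.integrable_reward_select harm t) (h.integrable_mean_select harm t),
    sub_eq_zero] at hnoise

lemma integrable_regret [IsFiniteMeasure μ] (h : B.Assumptions μ L M) (hbest : B.Predictable best)
    (harm : B.Predictable arm) (T : ℕ) : Integrable (B.regret best arm T) μ :=
  integrable_finsetSum _ fun t _ =>
    (h.integrable_mean_select hbest t).sub (h.integrable_mean_select harm t)

lemma expectedRegret_eq_integral_regret [IsFiniteMeasure μ] (h : B.Assumptions μ L M)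
    (hbest : B.Predictable best) (harm : B.Predictable arm) (T : ℕ) :
    B.expectedRegret μ best arm T = ∫ ω, B.regret best arm T ω ∂μ := by
  have hreward {sel : ℕ → Ω → Arm} (hsel : B.Predictable sel) :
      ∫ ω, ∑ t ∈ Finset.range T, B.reward t (sel t ω) ω ∂μ
        = ∫ ω, ∑ t ∈ Finset.range T, B.mean t (sel t ω) ω ∂μ := by
    rw [integral_finsetSum _ fun t _ => h.integrable_reward_select hsel t,
      integral_finsetSum _ fun t _ => h.integrable_mean_select hsel t]
    exact Finset.sum_congr rfl fun t _ => h.integral_reward_select hsel t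
  simp only [expectedRegret, regret, Finset.sum_sub_distrib]
  rw [hreward hbest, hreward harm, integral_sub
    (integrable_finsetSum _ fun t _ => h.integrable_mean_select hbest t)
    (integrable_finsetSum _ fun t _ => h.integrable_mean_select harm t)]

end Assumptions
end Bandit

/-! ### The regret of Fair-LinUCB -/

lemma one_le_confRadius {d : ℕ} {lam δ : ℝ} (hlam : 0 < lam) (hδ : 0 < δ) (hδ' : δ ≤ 1 / 2)
    (θ : Feature d) (X : ℕ → Feature d) (t : ℕ) : 1 ≤ confRadius lam δ θ X t := by
  have hdet := (gram_posDef hlam X t).det_pos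
  have hlog : 1 / 2 ≤ Real.log (√(gram lam X t).det * (√(lam ^ d))⁻¹ * δ⁻¹) := by
    rw [← div_eq_mul_inv (√_), ← Real.sqrt_div hdet.le,
      Real.log_mul (by positivity) (by positivity), Real.log_sqrt (by positivity)]
    have hlevel : Real.log 2 ≤ Real.log δ⁻¹ :=
      Real.log_le_log two_pos ((le_inv_comm₀ two_pos hδ).2 (by rwa [← one_div]))
    linarith [log_det_gram_div_nonneg hlam X t, Real.log_two_gt_d9]
  have hsqrt : 1 ≤ √(2 * Real.log (√(gram lam X t).det * (√(lam ^ d))⁻¹ * δ⁻¹)) :=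
    Real.one_le_sqrt.2 (by linarith)
  rw [confRadius, Matrix.det_smul, Matrix.det_one, mul_one, Fintype.card_fin]
  exact hsqrt.trans (le_add_of_nonneg_left (by positivity))

/-- The regret bound of Fair-LinUCB over `T` rounds at confidence level `δ`. -/
noncomputable def regretBound (d T : ℕ) (lam γ δ L M : ℝ) : ℝ :=
  (2 + γ) * horizonRadius d T lam δ L M
    * (√T * √(2 * (d * Real.log (1 + T * L ^ 2 / (d * lam)))))

lemma horizonRadius_nonneg (d T : ℕ) (lam δ L : ℝ) {M : ℝ} (hM : 0 ≤ M) :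
    0 ≤ horizonRadius d T lam δ L M :=
  add_nonneg (mul_nonneg (Real.sqrt_nonneg _) hM) (Real.sqrt_nonneg _)

lemma regretBound_nonneg (d T : ℕ) (lam δ L : ℝ) {γ M : ℝ} (hγ : 0 ≤ γ) (hM : 0 ≤ M) :
    0 ≤ regretBound d T lam γ δ L M := by
  have := horizonRadius_nonneg d T lam δ L hM
  unfold regretBound
  positivity

namespace Bandit

section Path

variable {d T : ℕ} {Arm Ω : Type*} [mΩ : MeasurableSpace Ω] {B : Bandit d Arm Ω} {μ : Measure Ω}
  {L M lam γ δ : ℝ} {α : ℕ → Ω → ℝ} {arm best : ℕ → Ω → Arm} {ω : Ω}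

lemma meanPayoff_mem_Icc (hpay : ∀ s, B.payoff arm ω s ∈ Set.Icc (0 : ℝ) 1) (t : ℕ)
    (P : ℕ → Prop) : B.meanPayoff arm ω t P ∈ Set.Icc (0 : ℝ) 1 := by
  classical
  rw [meanPayoff]
  refine ⟨div_nonneg (Finset.sum_nonneg fun s _ => (hpay s).1) (Nat.cast_nonneg _),
    div_le_one_of_le₀ ?_ (Nat.cast_nonneg _)⟩
  simpa using Finset.sum_le_card_nsmul _ (fun s => B.payoff arm ω s) 1 fun s _ => (hpay s).2

lemma abs_penalty_le_one (hpay : ∀ s, B.payoff arm ω s ∈ Set.Icc (0 : ℝ) 1) (t : ℕ) (a : Arm) :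
    |B.penalty arm t a ω| ≤ 1 := by
  have hgap : |B.armGroupMean arm t a ω true - B.armGroupMean arm t a ω false| ≤ 1 :=
    (abs_sub_le_of_le_of_le (meanPayoff_mem_Icc hpay t _).1 (meanPayoff_mem_Icc hpay t _).2
      (meanPayoff_mem_Icc hpay t _).1 (meanPayoff_mem_Icc hpay t _).2).trans_eq (sub_zero 1)
  have hsign (r : ℝ) : |Real.sign r| ≤ 1 := by
    rcases Real.sign_apply_eq r with h | h | h <;> simp [h]
  rw [penalty, abs_mul, abs_neg]
  exact mul_le_one₀ (hsign _) (abs_nonneg _) hgap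

lemma width_nonneg (B : Bandit d Arm Ω) (lam : ℝ) (arm : ℕ → Ω → Arm) (t : ℕ) (a : Arm) (ω : Ω) :
    0 ≤ B.width lam arm t a ω :=
  wnorm_nonneg _ _

lemma minWidth_nonneg (B : Bandit d Arm Ω) (lam : ℝ) (arm : ℕ → Ω → Arm) (t : ℕ) (ω : Ω) :
    0 ≤ B.minWidth lam arm t ω :=
  (Finset.le_inf'_iff _ _).2 fun a _ => B.width_nonneg lam arm t a ω

lemma minWidth_le_width {t : ℕ} {a : Arm} (ha : a ∈ B.avail t ω) :
    B.minWidth lam arm t ω ≤ B.width lam arm t a ω :=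
  Finset.inf'_le _ ha

-- The penalties differ by at most two, so fairness costs at most `γ α_t` times the least width.
lemma IsFairLinUCB.mean_sub_mean_le (hlin : B.IsFairLinUCB lam γ α arm) (hγ : 0 ≤ γ)
    (hpay : ∀ s, B.payoff arm ω s ∈ Set.Icc (0 : ℝ) 1) {t : ℕ} (hα : 0 ≤ α t ω)
    (hconf : ∀ a, |inner ℝ (ridge lam (B.pulledX arm ω) (B.payoff arm ω) t) (B.x t a ω)
      - B.mean t a ω| ≤ α t ω * B.width lam arm t a ω) {a : Arm} (ha : a ∈ B.avail t ω) :
    B.mean t a ω - B.mean t (arm t ω) ω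
      ≤ (2 + γ) * α t ω * B.width lam arm t (arm t ω) ω := by
  have hindex := hlin.index_le t ω a ha
  have hlower := (abs_le.1 (hconf a)).1
  have hupper := (abs_le.1 (hconf (arm t ω))).2
  have hpenalty : (B.penalty arm t (arm t ω) ω - B.penalty arm t a ω) / 2 ≤ 1 := by
    linarith [(abs_le.1 (abs_penalty_le_one hpay t a)).1,
      (abs_le.1 (abs_penalty_le_one hpay t (arm t ω))).2]
  have hmin := minWidth_le_width (lam := lam) (arm := arm) (hlin.mem t ω)
  have hmin0 := B.minWidth_nonneg lam arm t ω
  have hfair : α t ω * B.minWidth lam arm t ω / 2 * (B.penalty arm t (arm t ω) ω + 1) * γ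
      - α t ω * B.minWidth lam arm t ω / 2 * (B.penalty arm t a ω + 1) * γ
      ≤ γ * α t ω * B.width lam arm t (arm t ω) ω := by
    calc _ = γ * α t ω * B.minWidth lam arm t ω
            * ((B.penalty arm t (arm t ω) ω - B.penalty arm t a ω) / 2) := by ring
      _ ≤ γ * α t ω * B.minWidth lam arm t ω * 1 := by gcongr
      _ ≤ γ * α t ω * B.width lam arm t (arm t ω) ω := by rw [mul_one]; gcongr
  simp only [index] at hindex
  linarith

lemma abs_ridge_sub_mean_le (hlam : 0 < lam)
    (hexp : B.IsExploration T lam δ L M arm α) {t : ℕ} (ht : t < T)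
    (hmix : mixture lam (B.pulledX arm ω) (B.pulledNoise arm ω) t < δ⁻¹) (a : Arm) :
    |inner ℝ (ridge lam (B.pulledX arm ω) (B.payoff arm ω) t) (B.x t a ω) - B.mean t a ω|
      ≤ α t ω * B.width lam arm t a ω :=
  (abs_inner_ridge_sub_le hlam (B.payoff_eq_inner_add_pulledNoise arm ω) hmix (B.x t a ω)).trans
    (mul_le_mul_of_nonneg_right (hexp.ge t ht ω) (wnorm_nonneg _ _))

lemma mean_sub_mean_le_mul_min_one_width (hlam : 0 < lam) (hδ : 0 < δ) (hδ' : δ ≤ 1 / 2)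
    (hγ : 0 ≤ γ) (hexp : B.IsExploration T lam δ L M arm α) (hlin : B.IsFairLinUCB lam γ α arm)
    (hpay : ∀ s, B.payoff arm ω s ∈ Set.Icc (0 : ℝ) 1) {t : ℕ} (ht : t < T)
    (hmean : ∀ a, B.mean t a ω ∈ Set.Icc (0 : ℝ) 1)
    (hmix : mixture lam (B.pulledX arm ω) (B.pulledNoise arm ω) t < δ⁻¹) {a : Arm}
    (ha : a ∈ B.avail t ω) :
    B.mean t a ω - B.mean t (arm t ω) ω
      ≤ (2 + γ) * horizonRadius d T lam δ L M * min 1 (B.width lam arm t (arm t ω) ω) := by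
  have hα : 1 ≤ α t ω := (one_le_confRadius hlam hδ hδ' _ _ t).trans (hexp.ge t ht ω)
  have hmin : 0 ≤ min 1 (B.width lam arm t (arm t ω) ω) :=
    le_min zero_le_one (B.width_nonneg lam arm t _ ω)
  calc B.mean t a ω - B.mean t (arm t ω) ω
      ≤ (2 + γ) * α t ω * min 1 (B.width lam arm t (arm t ω) ω) := by
        rw [mul_min_of_nonneg _ _ (by positivity), mul_one]
        refine le_min ?_ (hlin.mean_sub_mean_le hγ hpay (by linarith)
          (abs_ridge_sub_mean_le hlam hexp ht hmix) ha)
        have hone : 1 ≤ (2 + γ) * α t ω := one_le_mul_of_one_le_of_one_le (by linarith) hα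
        linarith [(hmean a).2, (hmean (arm t ω)).1]
    _ ≤ (2 + γ) * horizonRadius d T lam δ L M * min 1 (B.width lam arm t (arm t ω) ω) := by
        gcongr
        exact hexp.le t ht ω

lemma regret_le_regretBound (hlam : 0 < lam) (hδ : 0 < δ) (hδ' : δ ≤ 1 / 2) (hγ : 0 ≤ γ)
    (h : B.Assumptions μ L M) (hexp : B.IsExploration T lam δ L M arm α)
    (hlin : B.IsFairLinUCB lam γ α arm) (hbest : ∀ t ω, best t ω ∈ B.avail t ω)
    (hreward : ∀ t a, B.reward t a ω ∈ Set.Icc (0 : ℝ) 1)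
    (hmean : ∀ t a, B.mean t a ω ∈ Set.Icc (0 : ℝ) 1)
    (hmix : ∀ t < T, mixture lam (B.pulledX arm ω) (B.pulledNoise arm ω) t < δ⁻¹) :
    B.regret best arm T ω ≤ regretBound d T lam γ δ L M := by
  have hradius := horizonRadius_nonneg d T lam δ L ((norm_nonneg _).trans h.norm_θ_lt.le)
  calc B.regret best arm T ω
      ≤ ∑ t ∈ Finset.range T,
          (2 + γ) * horizonRadius d T lam δ L M * min 1 (B.width lam arm t (arm t ω) ω) :=
        Finset.sum_le_sum fun t ht => mean_sub_mean_le_mul_min_one_width hlam hδ hδ' hγ hexp hlin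
          (fun s => hreward s _) (Finset.mem_range.1 ht) (hmean t) (hmix t (Finset.mem_range.1 ht))
          (hbest t ω)
    _ = (2 + γ) * horizonRadius d T lam δ L M
          * ∑ t ∈ Finset.range T, min 1 (B.width lam arm t (arm t ω) ω) :=
        (Finset.mul_sum _ _ _).symm
    _ ≤ regretBound d T lam γ δ L M := by
        refine mul_le_mul_of_nonneg_left ?_ (by positivity)
        exact sum_min_one_wnorm_le hlam (fun s => (h.norm_x_lt s _ ω).le) T

lemma regret_le_card_rounds (hmean : ∀ t a, B.mean t a ω ∈ Set.Icc (0 : ℝ) 1) (T : ℕ) :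
    B.regret best arm T ω ≤ T := by
  rw [regret]
  refine (Finset.sum_le_card_nsmul (Finset.range T) _ 1 fun t _ =>
    ((sub_le_self_iff _).2 (hmean t (arm t ω)).1).trans (hmean t (best t ω)).2).trans_eq ?_
  simp

end Path

end Bandit

/-! ### Regret with high probability and in expectation -/

section ExceptionalEvent

variable {Ω : Type*} [MeasurableSpace Ω] {μ : Measure Ω} [IsProbabilityMeasure μ]
  {f : Ω → ℝ} {s : Set Ω} {U K : ℝ}

lemma one_sub_measureReal_le_of_ae_le (hf : ∀ᵐ ω ∂μ, ω ∉ s → f ω ≤ U) :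
    1 - μ.real s ≤ μ.real {ω | f ω ≤ U} := by
  have hcover : μ.real Set.univ ≤ μ.real (s ∪ {ω | f ω ≤ U}) := by
    refine ENNReal.toReal_mono (measure_ne_top _ _) (measure_mono_ae ?_)
    filter_upwards [hf] with ω hω _
    exact or_iff_not_imp_left.2 hω
  rw [probReal_univ] at hcover
  linarith [measureReal_union_le (μ := μ) s {ω | f ω ≤ U}]

lemma integral_le_add_mul_measureReal (hs : MeasurableSet s) (hfint : Integrable f μ)
    (hU : 0 ≤ U) (hf : ∀ᵐ ω ∂μ, ω ∉ s → f ω ≤ U) (hK : ∀ᵐ ω ∂μ, f ω ≤ K) :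
    ∫ ω, f ω ∂μ ≤ U + K * μ.real s := by
  have hind : Integrable (s.indicator fun _ => K) μ := (integrable_const K).indicator hs
  calc ∫ ω, f ω ∂μ ≤ ∫ ω, (U + s.indicator (fun _ => K) ω) ∂μ := by
        refine integral_mono_ae hfint ((integrable_const U).add hind) ?_
        filter_upwards [hf, hK] with ω hω hKω
        by_cases hmem : ω ∈ s
        · simpa only [Set.indicator_of_mem hmem] using hKω.trans (le_add_of_nonneg_left hU)
        · simpa only [Set.indicator_of_notMem hmem, add_zero] using hω hmem
    _ = U + K * μ.real s := by
        rw [integral_add (integrable_const U) hind, integral_indicator hs]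
        simp [mul_comm]

end ExceptionalEvent

namespace Bandit

section Probability

variable {d T : ℕ} {Arm Ω : Type*} [MeasurableSpace Ω] {B : Bandit d Arm Ω} {μ : Measure Ω}
  {L M lam γ δ : ℝ} {α : ℕ → Ω → ℝ} {arm best : ℕ → Ω → Arm}

/-- The exceptional event of the confidence bound at level `δ`: before round `T`, the mixture
supermartingale of the pulled features and noises reaches `δ⁻¹`. -/
def exceptional (B : Bandit d Arm Ω) (lam δ : ℝ) (arm : ℕ → Ω → Arm) (T : ℕ) : Set Ω :=
  {ω | ∃ t < T, δ⁻¹ ≤ mixture lam (B.pulledX arm ω) (B.pulledNoise arm ω) t}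

lemma Assumptions.measurableSet_exceptional [Countable Arm] (h : B.Assumptions μ L M)
    (hlin : B.IsFairLinUCB lam γ α arm) (δ : ℝ) (T : ℕ) :
    MeasurableSet (B.exceptional lam δ arm T) := by
  have hmixture (t : ℕ) :
      Measurable fun ω => mixture lam (B.pulledX arm ω) (B.pulledNoise arm ω) t :=
    (measurable_mixture_filtration (h.measurable_pulledX hlin.predictable)
      (fun s => h.measurable_pulledNoise hlin.predictable (hlin.payoff_observed s)) t).mono
      (B.F.le t) le_rfl
  have hunion : B.exceptional lam δ arm T = ⋃ t ∈ Set.Iio T,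
      {ω | δ⁻¹ ≤ mixture lam (B.pulledX arm ω) (B.pulledNoise arm ω) t} := by
    ext ω
    simp [exceptional]
  rw [hunion]
  exact MeasurableSet.biUnion (Set.to_countable _) fun t _ =>
    measurableSet_le measurable_const (hmixture t)

lemma Assumptions.measureReal_exceptional_le [Countable Arm] [IsProbabilityMeasure μ]
    (h : B.Assumptions μ L M) (hlin : B.IsFairLinUCB lam γ α arm) (hlam : 0 < lam) (hδ : 0 < δ)
    (T : ℕ) : μ.real (B.exceptional lam δ arm T) ≤ δ := by
  simpa [exceptional] using measureReal_exists_le_mixture_le hlam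
    (h.measurable_pulledX hlin.predictable)
    (fun t => h.measurable_pulledNoise hlin.predictable (hlin.payoff_observed t))
    (h.condSubGaussian_pulledNoise hlin.predictable) (inv_pos.2 hδ) T

lemma ae_regret_le_regretBound [Countable Arm] [IsFiniteMeasure μ] (h : B.Assumptions μ L M)
    (hlam : 0 < lam) (hδ : 0 < δ) (hδ' : δ ≤ 1 / 2) (hγ : 0 ≤ γ)
    (hexp : B.IsExploration T lam δ L M arm α) (hlin : B.IsFairLinUCB lam γ α arm)
    (hbest : ∀ t ω, best t ω ∈ B.avail t ω) :
    ∀ᵐ ω ∂μ, ω ∉ B.exceptional lam δ arm T →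
      B.regret best arm T ω ≤ regretBound d T lam γ δ L M := by
  filter_upwards [h.ae_forall_reward_mem, h.ae_forall_mean_mem] with ω hreward hmean hω
  refine regret_le_regretBound hlam hδ hδ' hγ h hexp hlin hbest hreward hmean fun t ht => ?_
  exact not_le.1 fun hle => hω ⟨t, ht, hle⟩

theorem one_sub_le_measureReal_regret_le [Countable Arm] [IsProbabilityMeasure μ]
    (h : B.Assumptions μ L M) (hlam : 0 < lam) (hδ : 0 < δ) (hδ' : δ ≤ 1 / 2) (hγ : 0 ≤ γ)
    (hexp : B.IsExploration T lam δ L M arm α) (hlin : B.IsFairLinUCB lam γ α arm)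
    (hbest : ∀ t ω, best t ω ∈ B.avail t ω) :
    1 - δ ≤ μ.real {ω | B.regret best arm T ω ≤ regretBound d T lam γ δ L M} :=
  (sub_le_sub_left (h.measureReal_exceptional_le hlin hlam hδ T) 1).trans
    (one_sub_measureReal_le_of_ae_le
      (ae_regret_le_regretBound h hlam hδ hδ' hγ hexp hlin hbest))

theorem expectedRegret_le [Countable Arm] [IsProbabilityMeasure μ]
    (h : B.Assumptions μ L M) (hlam : 0 < lam) (hδ : 0 < δ) (hδ' : δ ≤ 1 / 2) (hγ : 0 ≤ γ)
    (hexp : B.IsExploration T lam δ L M arm α) (hlin : B.IsFairLinUCB lam γ α arm)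
    (hbest : B.Predictable best) (hbest_mem : ∀ t ω, best t ω ∈ B.avail t ω) :
    B.expectedRegret μ best arm T ≤ regretBound d T lam γ δ L M + T * δ := by
  have hM : 0 ≤ M := (norm_nonneg _).trans h.norm_θ_lt.le
  have hregret_le : ∀ᵐ ω ∂μ, B.regret best arm T ω ≤ T := by
    filter_upwards [h.ae_forall_mean_mem] with ω hmean using regret_le_card_rounds hmean T
  calc B.expectedRegret μ best arm T = ∫ ω, B.regret best arm T ω ∂μ :=
        h.expectedRegret_eq_integral_regret hbest hlin.predictable T
    _ ≤ regretBound d T lam γ δ L M + T * μ.real (B.exceptional lam δ arm T) :=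
        integral_le_add_mul_measureReal (h.measurableSet_exceptional hlin δ T)
          (h.integrable_regret hbest hlin.predictable T) (regretBound_nonneg d T lam δ L hγ hM)
          (ae_regret_le_regretBound h hlam hδ hδ' hγ hexp hlin hbest_mem) hregret_le
    _ ≤ regretBound d T lam γ δ L M + T * δ := by
        gcongr
        exact h.measureReal_exceptional_le hlin hlam hδ T

end Probability

end Bandit

/-! ### Absorbing the logarithms -/

section Constants

variable {lam c T L : ℝ}

lemma log_one_add_mul_sq_div_nonneg (hlam : 0 < lam) (hT : 0 ≤ T) (L : ℝ) :
    0 ≤ Real.log (1 + T * L ^ 2 / lam) :=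
  Real.log_nonneg (le_add_of_nonneg_right (by positivity))

/-- The factor of `log (T L)` in the bound on `log (1 + T L² / λ)` for `T L ≥ c`. -/
noncomputable def logFactor (lam c : ℝ) : ℝ :=
  2 + Real.log (1 + 1 / lam) / Real.log c

lemma logFactor_nonneg (hlam : 0 < lam) (hc : 1 < c) : 0 ≤ logFactor lam c :=
  add_nonneg zero_le_two (div_nonneg
    (Real.log_nonneg (le_add_of_nonneg_right (by positivity))) (Real.log_pos hc).le)

/-- The factor of `log (T L) ^ 2` in the bound on `log (1 + T L² / λ) * log T` for `T L ≥ c`. -/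
noncomputable def logMulLogFactor (lam c : ℝ) : ℝ :=
  2 * logFactor lam c + 1 / (lam * Real.log c ^ 2)

lemma logMulLogFactor_nonneg (hlam : 0 < lam) (hc : 1 < c) : 0 ≤ logMulLogFactor lam c := by
  have := logFactor_nonneg hlam hc
  unfold logMulLogFactor
  positivity

lemma log_one_add_mul_sq_div_le (hlam : 0 < lam) (hc : 1 < c) (hT : 1 ≤ T) (hTL : c ≤ T * L) :
    Real.log (1 + T * L ^ 2 / lam)
      ≤ logFactor lam c * Real.log (T * L) := by
  have hκ : 0 < Real.log c := Real.log_pos hc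
  have hκTL : Real.log c ≤ Real.log (T * L) := Real.log_le_log (by linarith) hTL
  have hlog : 0 ≤ Real.log (1 + 1 / lam) :=
    Real.log_nonneg (le_add_of_nonneg_right (by positivity))
  have hTL0 : 0 < T * L := by linarith
  have hsq : T * L ^ 2 ≤ (T * L) ^ 2 := by
    rw [mul_pow]
    exact mul_le_mul_of_nonneg_right (le_self_pow₀ hT two_ne_zero) (sq_nonneg L)
  calc Real.log (1 + T * L ^ 2 / lam)
      ≤ Real.log ((T * L) ^ 2 + (T * L) ^ 2 / lam) := by
        have : 1 ≤ (T * L) ^ 2 := one_le_pow₀ (by linarith)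
        gcongr
    _ = Real.log ((T * L) ^ 2 * (1 + 1 / lam)) := by ring_nf
    _ = 2 * Real.log (T * L) + Real.log (1 + 1 / lam) / Real.log c * Real.log c := by
        rw [Real.log_mul (by positivity) (by positivity), Real.log_pow, div_mul_cancel₀ _ hκ.ne',
          Nat.cast_ofNat]
    _ ≤ logFactor lam c * Real.log (T * L) := by
        rw [logFactor, add_mul]
        gcongr

-- `log T` may be much larger than `log (T L)`, but then `T L²` is small: write
-- `T = s (T L)²` and use `log (1 + 1 / (λ s)) log s ≤ 1 / λ`.
lemma log_one_add_mul_sq_div_mul_log_le (hlam : 0 < lam) (hc : 1 < c) (hT : 1 ≤ T)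
    (hTL : c ≤ T * L) :
    Real.log (1 + T * L ^ 2 / lam) * Real.log T
      ≤ logMulLogFactor lam c * Real.log (T * L) ^ 2 := by
  have hκ : 0 < Real.log c := Real.log_pos hc
  have hκTL : Real.log c ≤ Real.log (T * L) := Real.log_le_log (by linarith) hTL
  have hTL0 : 0 < T * L := by linarith
  have hT0 : 0 < T := by linarith
  have hl := log_one_add_mul_sq_div_nonneg hlam hT0.le L
  set s := T / (T * L) ^ 2 with hs
  have hs0 : 0 < s := by positivity
  have hlogT : Real.log T = Real.log s + 2 * Real.log (T * L) := by
    rw [hs, Real.log_div hT0.ne' (by positivity), Real.log_pow, Nat.cast_ofNat, sub_add_cancel]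
  have hl_le : Real.log (1 + T * L ^ 2 / lam) ≤ 1 / (lam * s) := by
    have hL : L ≠ 0 := by rintro rfl; simp at hTL0
    calc Real.log (1 + T * L ^ 2 / lam) ≤ T * L ^ 2 / lam := by
          linarith [Real.log_le_sub_one_of_pos (show 0 < 1 + T * L ^ 2 / lam by positivity)]
      _ = 1 / (lam * s) := by rw [hs]; field_simp
  have hlogs : Real.log s ≤ s := (Real.log_le_sub_one_of_pos hs0).trans (sub_le_self s zero_le_one)
  calc Real.log (1 + T * L ^ 2 / lam) * Real.log T
      ≤ Real.log (1 + T * L ^ 2 / lam) * (s + 2 * Real.log (T * L)) := by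
        rw [hlogT]
        gcongr
    _ = Real.log (1 + T * L ^ 2 / lam) * s
          + 2 * (Real.log (1 + T * L ^ 2 / lam) * Real.log (T * L)) := by ring
    _ ≤ 1 / (lam * s) * s + 2 * (logFactor lam c * Real.log (T * L) * Real.log (T * L)) := by
        have hD : 0 ≤ Real.log (T * L) := hκ.le.trans hκTL
        gcongr
        exact log_one_add_mul_sq_div_le hlam hc hT hTL
    _ = 2 * logFactor lam c * Real.log (T * L) ^ 2
          + 1 / (lam * Real.log c ^ 2) * Real.log c ^ 2 := by
        field_simp
        ring
    _ ≤ logMulLogFactor lam c * Real.log (T * L) ^ 2 := by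
        rw [logMulLogFactor, add_mul]
        gcongr

lemma sqrt_two_mul_le {d κ a l D : ℝ} (hd : 1 ≤ d) (hκ : 0 < κ) (hκD : κ ≤ D) (ha : 0 ≤ a)
    (hl : l ≤ a * D) : √(2 * (d * l)) ≤ √(2 * a / κ) * (d * D) := by
  have hD : 0 < D := hκ.trans_le hκD
  rw [← Real.sqrt_sq (by positivity : 0 ≤ d * D), ← Real.sqrt_mul (by positivity)]
  refine Real.sqrt_le_sqrt ?_
  calc 2 * (d * l) ≤ 2 * (d * (a * D)) := by gcongr
    _ ≤ 2 * (d ^ 2 * (a * D)) := by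
        gcongr
        exact le_self_pow₀ hd two_ne_zero
    _ = 2 * a / κ * (d ^ 2 * D) * κ := by field_simp
    _ ≤ 2 * a / κ * (d ^ 2 * D) * D := by gcongr
    _ = 2 * a / κ * (d * D) ^ 2 := by ring

lemma sqrt_two_mul_add_mul_sqrt_le {d τ a b l D : ℝ} (hd : 1 ≤ d) (hτ : 0 ≤ τ) (hl0 : 0 ≤ l)
    (hD : 0 ≤ D) (hb : 0 ≤ b) (hl : l ≤ a * D) (hlτ : l * τ ≤ b * D ^ 2) :
    √(2 * τ + d * l) * √(2 * (d * l)) ≤ √(4 * b + 2 * a ^ 2) * (d * D) := by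
  rw [← Real.sqrt_mul (by positivity), ← Real.sqrt_sq (by positivity : 0 ≤ d * D),
    ← Real.sqrt_mul (by positivity)]
  refine Real.sqrt_le_sqrt ?_
  calc (2 * τ + d * l) * (2 * (d * l)) = 4 * (d * (l * τ)) + 2 * d ^ 2 * l ^ 2 := by ring
    _ ≤ 4 * (d ^ 2 * (b * D ^ 2)) + 2 * d ^ 2 * (a * D) ^ 2 := by
        gcongr
        exact le_self_pow₀ hd two_ne_zero
    _ = (4 * b + 2 * a ^ 2) * (d * D) ^ 2 := by ring

/-- The factor of `d log (T L)` in the bound on the horizon radius times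
`√(2 d log (1 + T L² / (d λ)))`, at confidence level `1 / T`. -/
noncomputable def radiusFactor (lam M c : ℝ) : ℝ :=
  √lam * M * √(2 * logFactor lam c / Real.log c)
    + √(4 * logMulLogFactor lam c + 2 * logFactor lam c ^ 2)

lemma radiusFactor_nonneg {M : ℝ} (hM : 0 ≤ M) (lam c : ℝ) : 0 ≤ radiusFactor lam M c := by
  unfold radiusFactor
  positivity

lemma horizonRadius_mul_sqrt_le {d T : ℕ} {M : ℝ} (hlam : 0 < lam) (hM : 0 ≤ M) (hc : 1 < c)
    (hd : 1 ≤ d) (hT : 1 ≤ T) (hTL : c ≤ T * L) :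
    horizonRadius d T lam (1 / T) L M * √(2 * (d * Real.log (1 + T * L ^ 2 / (d * lam))))
      ≤ radiusFactor lam M c * (d * Real.log (T * L)) := by
  have hd' : (1 : ℝ) ≤ d := by exact_mod_cast hd
  have hT' : (1 : ℝ) ≤ T := by exact_mod_cast hT
  have hκ : 0 < Real.log c := Real.log_pos hc
  have hκTL : Real.log c ≤ Real.log (T * L) := Real.log_le_log (by linarith) hTL
  have hlogT : 0 ≤ Real.log T := Real.log_nonneg hT'
  have hl0 := log_one_add_mul_sq_div_nonneg (by positivity : 0 < d * lam) T.cast_nonneg L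
  have hl : Real.log (1 + T * L ^ 2 / (d * lam)) ≤ Real.log (1 + T * L ^ 2 / lam) := by
    gcongr
    exact le_mul_of_one_le_left hlam.le hd'
  have hla := hl.trans (log_one_add_mul_sq_div_le hlam hc hT' hTL)
  have hlb := (mul_le_mul_of_nonneg_right hl hlogT).trans
    (log_one_add_mul_sq_div_mul_log_le hlam hc hT' hTL)
  rw [horizonRadius, one_div_one_div, radiusFactor, add_mul, add_mul, mul_assoc (√lam * M)]
  exact add_le_add
    (mul_le_mul_of_nonneg_left (sqrt_two_mul_le hd' hκ hκTL (logFactor_nonneg hlam hc) hla)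
      (by positivity))
    (sqrt_two_mul_add_mul_sqrt_le hd' hlogT hl0 (hκ.le.trans hκTL)
      (logMulLogFactor_nonneg hlam hc) hla hlb)

/-- The constant `C'` of the regret bound `C' d √T log (T L)`; its last summand absorbs the
contribution `1` of the exceptional event to the expected regret. -/
noncomputable def regretFactor (lam M Γ c : ℝ) : ℝ :=
  (2 + Γ) * radiusFactor lam M c + 1 / Real.log c

lemma regretFactor_pos {M Γ : ℝ} (hM : 0 ≤ M) (hΓ : 0 ≤ Γ) (hc : 1 < c) (lam : ℝ) :
    0 < regretFactor lam M Γ c := by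
  have := radiusFactor_nonneg hM lam c
  have := Real.log_pos hc
  unfold regretFactor
  positivity

lemma regretBound_add_one_le {d T : ℕ} {M γ Γ : ℝ} (hlam : 0 < lam) (hM : 0 ≤ M)
    (hγ : 0 ≤ γ) (hγΓ : γ ≤ Γ) (hc : 1 < c) (hd : 1 ≤ d) (hT : 1 ≤ T) (hTL : c ≤ T * L) :
    regretBound d T lam γ (1 / T) L M + 1
      ≤ regretFactor lam M Γ c * d * √T * Real.log (T * L) := by
  have hd' : (1 : ℝ) ≤ d := by exact_mod_cast hd
  have hT' : 1 ≤ √(T : ℝ) := Real.one_le_sqrt.2 (by exact_mod_cast hT)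
  have hκ : 0 < Real.log c := Real.log_pos hc
  have hκTL : Real.log c ≤ Real.log (T * L) := Real.log_le_log (by linarith) hTL
  have hD : 0 ≤ Real.log (T * L) := hκ.le.trans hκTL
  have hone : 1 ≤ 1 / Real.log c * (d * √T * Real.log (T * L)) := by
    rw [div_mul_eq_mul_div, one_mul, one_le_div hκ]
    exact hκTL.trans (le_mul_of_one_le_left hD (one_le_mul_of_one_le_of_one_le hd' hT'))
  have hradius := radiusFactor_nonneg hM lam c
  calc regretBound d T lam γ (1 / T) L M + 1
      = (2 + γ) * (√T * (horizonRadius d T lam (1 / T) L M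
          * √(2 * (d * Real.log (1 + T * L ^ 2 / (d * lam)))))) + 1 := by
        rw [regretBound]
        ring
    _ ≤ (2 + γ) * (√T * (radiusFactor lam M c * (d * Real.log (T * L))))
          + 1 / Real.log c * (d * √T * Real.log (T * L)) := by
        refine add_le_add ?_ hone
        exact mul_le_mul_of_nonneg_left (mul_le_mul_of_nonneg_left
          (horizonRadius_mul_sqrt_le hlam hM hc hd hT hTL) (Real.sqrt_nonneg _)) (by linarith)
    _ ≤ (2 + Γ) * (√T * (radiusFactor lam M c * (d * Real.log (T * L))))
          + 1 / Real.log c * (d * √T * Real.log (T * L)) := by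
        gcongr
    _ = regretFactor lam M Γ c * d * √T * Real.log (T * L) := by
        rw [regretFactor]
        ring

end Constants

end FairLinUCB

theorem mainTheorem2_general (lam M Γ c : ℝ) (hlam : 0 < lam) (hΓ : 0 ≤ Γ) (hc : 1 < c) :
    ∃ C : ℝ, 0 < C ∧
      ∀ (d T : ℕ) (L : ℝ), 1 ≤ d → 2 ≤ T → c ≤ T * L →
      ∀ (Ω Arm : Type*) [MeasurableSpace Ω] [Countable Arm]
        (μ : MeasureTheory.Measure Ω) [MeasureTheory.IsProbabilityMeasure μ]
        (B : FairLinUCB.Bandit d Arm Ω) (γ : ℝ) (α : ℕ → Ω → ℝ) (arm best : ℕ → Ω → Arm),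
        B.Assumptions μ L M →
        0 ≤ γ → γ ≤ Γ →
        B.IsExploration T lam (1 / (T : ℝ)) L M arm α →
        B.IsFairLinUCB lam γ α arm →
        B.IsBestArm best →
        1 - 1 / (T : ℝ) ≤
            μ.real {ω | B.regret best arm T ω ≤ C * d * √(T : ℝ) * Real.log (T * L)} ∧
          B.expectedRegret μ best arm T ≤ C * d * √(T : ℝ) * Real.log (T * L) := by
  refine ⟨FairLinUCB.regretFactor lam |M| Γ c,
    FairLinUCB.regretFactor_pos (abs_nonneg M) hΓ hc lam, ?_⟩
  intro d T L hd hT hTL Ω Arm _ _ μ _ B γ α arm best h hγ hγΓ hexp hlin hbest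
  have hM : 0 ≤ M := (norm_nonneg _).trans h.norm_θ_lt.le
  have hT0 : (0 : ℝ) < T := by positivity
  have hδ : 1 / (T : ℝ) ≤ 1 / 2 := one_div_le_one_div_of_le two_pos (by exact_mod_cast hT)
  have hbound := FairLinUCB.regretBound_add_one_le hlam hM hγ hγΓ hc hd (by lia) hTL
  have hexpected := FairLinUCB.Bandit.expectedRegret_le h hlam (one_div_pos.2 hT0) hδ hγ hexp hlin
    hbest.predictable hbest.mem
  rw [mul_one_div_cancel hT0.ne'] at hexpected
  rw [abs_of_nonneg hM]
  refine ⟨?_, hexpected.trans hbound⟩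
  exact (FairLinUCB.Bandit.one_sub_le_measureReal_regret_le h hlam (one_div_pos.2 hT0) hδ hγ hexp
    hlin hbest.mem).trans
      (MeasureTheory.measureReal_mono fun ω hω => hω.out.trans (by linarith))

theorem mainTheorem2 (lam M Γ c : ℝ) (hlam : 0 < lam) (hΓ : 0 ≤ Γ) (hc : 1 < c) :
    ∃ C : ℝ, 0 < C ∧
      ∀ (d T : ℕ) (L : ℝ), 1 ≤ d → 2 ≤ T → c ≤ T * L →
      ∀ (Ω Arm : Type*) [MeasurableSpace Ω] [Finite Arm]
        (μ : MeasureTheory.Measure Ω) [MeasureTheory.IsProbabilityMeasure μ]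
        (B : FairLinUCB.Bandit d Arm Ω) (γ : ℝ) (α : ℕ → Ω → ℝ) (arm best : ℕ → Ω → Arm),
        B.Assumptions μ L M →
        0 ≤ γ → γ ≤ Γ →
        B.IsExploration T lam (1 / (T : ℝ)) L M arm α →
        B.IsFairLinUCB lam γ α arm →
        B.IsBestArm best →
        1 - 1 / (T : ℝ) ≤
            μ.real {ω | B.regret best arm T ω ≤ C * d * √(T : ℝ) * Real.log (T * L)} ∧
          B.expectedRegret μ best arm T ≤ C * d * √(T : ℝ) * Real.log (T * L) := by
  obtain ⟨C, hC, hregret⟩ := mainTheorem2_general lam M Γ c hlam hΓ hc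
  exact ⟨C, hC, fun d T L hd hT hTL Ω Arm _ _ μ => hregret d T L hd hT hTL Ω Arm μ⟩
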